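/- Let $\mathfrak g$ be a finite-dimensional simple complex Lie algebra of classical type ($A_n$, $B_n$, $C_n$ or $D_n$) with Cartan subalgebra $\mathfrak h$ and root spaces $\mathfrak g_\alpha$, and let $(\,,)$ be the multiple of the Killing form for which $(\theta,\theta)=2$ for a long root $\theta$. Let $\widehat{\mathfrak g}=\mathfrak g\otimes\mathbb C((\xi))\oplus\mathbb C c$, with $c$ central and $$[X\otimes f,\,Y\otimes g]=[X,Y]\otimes fg+(X,Y)\,\mathrm{Res}_{\xi=0}(g\,df)\,c .$$ For $\mu$ in the coweight lattice $P^\vee=\{\mu\in\mathfrak h:\alpha(\mu)\in\mathbb Z\text{ for all roots }\alpha\}$, the single-shift map $\sigma_\mu:\widehat{\mathfrak g}\to\widehat{\mathfrak g}$ is the linear map with $$\sigma_\mu(c)=c,\qquad \sigma_\mu(h\otimes f)=h\otimes f+(\mu,h)f_0\,c\ \ (h\in\mathfrak h),\qquad \sigma_\mu(X\otimes f)=X\otimes \xi^{\alpha(\mu)}f\ \ (X\in\mathfrak g_\alpha),$$ where $f_0$ is the constant coefficient of $f\in\mathbb C((\xi))$. Let $G$ be the simply connected complex Lie group with Lie algebra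 $\mathfrak g$, realized as the subgroup of some $GL_N(\mathbb C)$ generated by $\exp(\rho(\mathfrak g))$ for a faithful representation $\rho$ of $\mathfrak g$, and let $G(\mathbb C((\xi)))$ be the group of $\mathbb C((\xi))$-points of the algebraic group $G$. Let $\mathcal G$ be the Kac–Moody group of $\widehat{\mathfrak g}$: the group generated by symbols $\exp(X\otimes f)$ ($X$ a root vector of $\mathfrak g$, $f\in\mathbb C((\xi))$), modulo the words that act trivially in $G(\mathbb C((\xi)))$ (where the symbol acts as $\exp(f\rho(X))$), in the adjoint action $\mathrm{Ad}$ on $\widehat{\mathfrak g}$ (where it acts as $\exp(\mathrm{ad}(X\otimes f))$), and in every smooth integrable $\widehat{\mathfrak g}$-module (where it acts as the exponential of $X\otimes f$). Here a $\widehat{\mathfrak g}$-module is smooth if each of its vectors is killed by $\mathfrak g\otimes\xi^N\mathbb C[[\xi]]$ for some $N$, and integrable if all $X\otimes f$ with $X$ a root vector act locally nilpotently. It comes with a homomorphism $\mathcal G\to G(\mathbb C((\xi)))$ and the adjoint action $\mathrm{Ad}:\mathcal G\to\mathrm{Aut}(\widehat{\mathfrak g})$. If $\mu$ lies in the coroot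 lattice $Q^\vee$ (the subgroup of $\mathfrak h$ generated by the coroots), then $\sigma_\mu$ is an inner automorphism of $\widehat{\mathfrak g}$. More precisely: $\tau_\mu=\exp(\ln\xi\cdot\mu)$, the value at $t=\xi$ of the one-parameter subgroup $e^{s}\mapsto\exp(s\rho(\mu))$, which is a Laurent polynomial in $t=e^{s}$, is a well-defined element of $G(\mathbb C((\xi)))$; it has a lift to $\mathcal G$; and for every lift $\tilde\tau_\mu\in\mathcal G$ of $\tau_\mu$, $$\sigma_\mu=\mathrm{Ad}(\tilde\tau_\mu).$$ -/

import Mathlib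

open scoped TensorProduct

attribute [local instance 100] LieRing.ofAssociativeRing

noncomputable section

namespace SingleShift

/-! ### Formal Laurent series and residues -/

/-- The field `ℂ((ξ))` of formal Laurent series, with its standard `ℂ`-algebra structure. -/
def Laurent : Type := LaurentSeries ℂ

instance : Field Laurent := inferInstanceAs (Field (LaurentSeries ℂ))
instance : Algebra ℂ Laurent := HahnSeries.instAlgebra (Γ := ℤ) (R := ℂ) (A := ℂ)
instance : Algebra ℚ Laurent := Algebra.compHom Laurent (algebraMap ℚ ℂ)

namespace Laurent

/-- The coefficient of `ξ ^ n`. -/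
def coeff (n : ℤ) : Laurent →ₗ[ℂ] ℂ where
  toFun f := HahnSeries.coeff f n
  map_add' _ _ := rfl
  map_smul' _ _ := rfl

/-- The monomial `ξ ^ n`. -/
def xi (n : ℤ) : Laurent := (HahnSeries.single n 1 : LaurentSeries ℂ)

/-- The Laurent series given by a power series. -/
def ofPowerSeries (f : PowerSeries ℂ) : Laurent := HahnSeries.ofPowerSeries ℤ ℂ f

/-- The formal derivative `d/dξ`. -/
def derivative : Laurent →ₗ[ℂ] Laurent where
  toFun f := LaurentSeries.derivative ℂ (show LaurentSeries ℂ from f)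
  map_add' f g := (LaurentSeries.derivative ℂ).map_add f g
  map_smul' c f := (LaurentSeries.derivative ℂ).map_smul c f

/-- The residue at `ξ = 0`: the coefficient of `ξ ^ (-1)`. -/
def residue : Laurent →ₗ[ℂ] ℂ := coeff (-1)

/-- The bilinear pairing `(f, g) ↦ Res (g df)`. -/
def resPairing : LinearMap.BilinForm ℂ Laurent :=
  LinearMap.mk₂ ℂ (fun f g ↦ residue (g * derivative f))
    (fun f f' g ↦ by rw [map_add, mul_add, map_add])
    (fun c f g ↦ by rw [map_smul, mul_smul_comm, map_smul])
    (fun f g g' ↦ by rw [add_mul, map_add])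
    (fun c f g ↦ by rw [smul_mul_assoc, map_smul])

theorem resPairing_apply (f g : Laurent) : resPairing f g = residue (g * derivative f) := rfl

@[ext]
theorem ext {f g : Laurent} (h : ∀ n, coeff n f = coeff n g) : f = g :=
  HahnSeries.ext (funext h)

theorem coeff_derivative_aux (f : LaurentSeries ℂ) (n : ℤ) :
    (LaurentSeries.derivative ℂ f).coeff n = (n + 1 : ℂ) * f.coeff (n + 1) := by
  simp

theorem coeff_derivative (f : Laurent) (n : ℤ) :
    coeff n (derivative f) = (n + 1 : ℂ) * coeff (n + 1) f :=
  coeff_derivative_aux f n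

theorem residue_derivative (f : Laurent) : residue (derivative f) = 0 := by
  change coeff (-1) (derivative f) = 0
  rw [coeff_derivative]; simp

theorem finite_support_mul (f g : Laurent) (n : ℤ) :
    (Function.support fun k : ℤ ↦ coeff k f * coeff (n - k) g).Finite := by
  classical
  refine ((Finset.antidiagonal (HahnSeries.isPWO_support (show LaurentSeries ℂ from f))
    (HahnSeries.isPWO_support (show LaurentSeries ℂ from g)) n).image
    Prod.fst).finite_toSet.subset fun k hk ↦ ?_
  simp only [Finset.coe_image, Set.mem_image, Finset.mem_coe, Finset.mem_antidiagonal]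
  exact ⟨(k, n - k), ⟨left_ne_zero_of_mul hk, right_ne_zero_of_mul hk, by simp⟩, rfl⟩

theorem coeff_mul (f g : Laurent) (n : ℤ) :
    coeff n (f * g) = ∑ᶠ k : ℤ, coeff k f * coeff (n - k) g := by
  classical
  have h : coeff n (f * g) = ∑ ij ∈ Finset.antidiagonal
    (HahnSeries.isPWO_support (show LaurentSeries ℂ from f))
    (HahnSeries.isPWO_support (show LaurentSeries ℂ from g)) n,
      coeff ij.1 f * coeff ij.2 g := rfl
  rw [h, finsum_eq_sum_of_support_subset (s := (Finset.antidiagonal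
    (HahnSeries.isPWO_support (show LaurentSeries ℂ from f))
    (HahnSeries.isPWO_support (show LaurentSeries ℂ from g)) n).image Prod.fst)]
  · rw [Finset.sum_image]
    · refine Finset.sum_congr rfl fun ij h ↦ ?_
      rw [Finset.mem_antidiagonal] at h
      rw [← h.2.2]; simp
    · intro a ha b hb hab
      simp only [Finset.mem_coe, Finset.mem_antidiagonal] at ha hb
      ext
      · exact hab
      · have := ha.2.2.trans hb.2.2.symm
        rw [hab] at this; simpa using this
  · intro k hk
    simp only [Finset.coe_image, Set.mem_image, Finset.mem_coe, Finset.mem_antidiagonal]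
    exact ⟨(k, n - k), ⟨left_ne_zero_of_mul hk, right_ne_zero_of_mul hk, by simp⟩, rfl⟩

theorem derivative_mul (f g : Laurent) :
    derivative (f * g) = derivative f * g + f * derivative g := by
  ext n
  rw [map_add, coeff_derivative, coeff_mul, coeff_mul, coeff_mul]
  have e : (∑ᶠ k : ℤ, coeff k (derivative f) * coeff (n - k) g) =
      ∑ᶠ k : ℤ, (k : ℂ) * (coeff k f * coeff (n + 1 - k) g) := by
    rw [← finsum_comp_equiv (Equiv.addRight (1 : ℤ)).symm]
    refine finsum_congr fun k ↦ ?_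
    rw [coeff_derivative]
    simp only [Equiv.addRight_symm, Equiv.coe_addRight]
    push_cast
    rw [show k + -1 + 1 = k by ring, show n - (k + -1) = n + 1 - k by ring]
    ring
  rw [e, mul_finsum, ← finsum_add_distrib]
  · refine finsum_congr fun k ↦ ?_
    rw [coeff_derivative, show n - k + 1 = n + 1 - k by ring]
    push_cast
    ring
  · exact (finite_support_mul f g (n + 1)).subset fun k hk ↦ right_ne_zero_of_mul hk
  · exact finite_support_mul f _ n

theorem resPairing_self (f : Laurent) : resPairing f f = 0 := by
  have h := residue_derivative (f * f)
  rw [derivative_mul, map_add, mul_comm _ f] at h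
  rw [resPairing_apply]
  linear_combination h / 2

theorem resPairing_cyclic (f g h : Laurent) :
    resPairing f (g * h) + resPairing g (h * f) + resPairing h (f * g) = 0 := by
  have e := residue_derivative (f * g * h)
  rw [derivative_mul, derivative_mul, add_mul, map_add, map_add] at e
  simp only [resPairing_apply]
  rw [← e]
  congr 1
  congr 1 <;> congr 1 <;> ring

theorem resPairing_xi (m n : ℤ) :
    resPairing (xi m) (xi n) = if m + n = 0 then (m : ℂ) else 0 := by
  rw [resPairing_apply]
  have h : derivative (xi m) = (m : ℂ) • xi (m - 1) := by
    ext k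
    rw [coeff_derivative, map_smul]
    change _ * HahnSeries.coeff (HahnSeries.single m (1 : ℂ)) (k + 1) =
      _ * HahnSeries.coeff (HahnSeries.single (m - 1) (1 : ℂ)) k
    rw [HahnSeries.coeff_single, HahnSeries.coeff_single]
    by_cases hk : k + 1 = m
    · rw [if_pos hk, if_pos (by omega), ← hk]; push_cast; ring
    · rw [if_neg hk, if_neg (by omega)]; simp
  rw [h, mul_smul_comm, map_smul]
  have h2 : xi n * xi (m - 1) = xi (n + (m - 1)) := by
    have := HahnSeries.single_mul_single (a := n) (b := m - 1) (r := (1 : ℂ)) (s := 1)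
    rw [mul_one] at this
    exact this
  rw [h2]
  change _ * HahnSeries.coeff (HahnSeries.single (n + (m - 1)) (1 : ℂ)) (-1) = _
  rw [HahnSeries.coeff_single]
  by_cases hk : m + n = 0
  · rw [if_pos hk, if_pos (by omega), mul_one]
  · rw [if_neg hk, if_neg (by omega), mul_zero]

end Laurent

open Laurent

/-! ### The affine Lie algebra -/

section Affine

variable {g : Type*} [LieRing g] [LieAlgebra ℂ g] [FiniteDimensional ℂ g]
  [LieAlgebra.IsKilling ℂ g]

/-- The largest value of `(α, α)` over all roots `α`, for the form on `H*` induced by the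
Killing form. It is attained at the long roots. -/
def longRootNormSq (H : LieSubalgebra ℂ g) [H.IsCartanSubalgebra] : ℝ :=
  ⨆ α : H.root, (α.1 ((LieAlgebra.IsKilling.cartanEquivDual H).symm α.1.toLinear)).re

/-- The multiple of the Killing form for which a long root `θ` has `(θ, θ) = 2`. -/
def normalizedForm (H : LieSubalgebra ℂ g) [H.IsCartanSubalgebra] : LinearMap.BilinForm ℂ g :=
  ((longRootNormSq H : ℂ) / 2) • killingForm ℂ g

theorem normalizedForm_symm (H : LieSubalgebra ℂ g) [H.IsCartanSubalgebra] (x y : g) :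
    normalizedForm H x y = normalizedForm H y x := by
  simp only [normalizedForm, LinearMap.smul_apply]
  rw [LieModule.traceForm_comm]

theorem normalizedForm_lie (H : LieSubalgebra ℂ g) [H.IsCartanSubalgebra] (x y z : g) :
    normalizedForm H ⁅x, y⁆ z = normalizedForm H x ⁅y, z⁆ := by
  simp only [normalizedForm, LinearMap.smul_apply]
  rw [LieModule.traceForm_apply_lie_apply]

/-- The loop algebra `g ⊗ ℂ((ξ))`. -/
abbrev LoopAlgebra (g : Type*) [LieRing g] [LieAlgebra ℂ g] : Type _ := Laurent ⊗[ℂ] g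

/-- The cocycle `(X ⊗ f, Y ⊗ g) ↦ (X, Y) Res (g df)` on the loop algebra. -/
def affineCocycle (H : LieSubalgebra ℂ g) [H.IsCartanSubalgebra] :
    LinearMap.BilinForm ℂ (LoopAlgebra g) :=
  LinearMap.BilinForm.tmul resPairing (normalizedForm H)

theorem affineCocycle_tmul (H : LieSubalgebra ℂ g) [H.IsCartanSubalgebra] (f f' : Laurent)
    (x y : g) : affineCocycle H (f ⊗ₜ x) (f' ⊗ₜ y) =
      normalizedForm H x y * residue (f' * derivative f) := rfl

theorem affineCocycle_skew (H : LieSubalgebra ℂ g) [H.IsCartanSubalgebra] (x y : LoopAlgebra g) :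
    affineCocycle H x y = -affineCocycle H y x := by
  have h : ∀ f f' : Laurent, resPairing f f' = -resPairing f' f := fun f f' ↦ by
    have := resPairing_self (f + f')
    simp only [map_add, LinearMap.add_apply, resPairing_self] at this
    linear_combination this
  induction x using TensorProduct.induction_on with
  | zero => simp
  | add x x' hx hx' => simp only [map_add, LinearMap.add_apply, hx, hx']; ring
  | tmul f a =>
    induction y using TensorProduct.induction_on with
    | zero => simp
    | add y y' hy hy' => simp only [map_add, LinearMap.add_apply, hy, hy']; ring
    | tmul f' b =>
      rw [affineCocycle_tmul, affineCocycle_tmul, ← resPairing_apply, ← resPairing_apply, h f f',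
        normalizedForm_symm]
      ring

theorem affineCocycle_self (H : LieSubalgebra ℂ g) [H.IsCartanSubalgebra] (x : LoopAlgebra g) :
    affineCocycle H x x = 0 := by
  have := affineCocycle_skew H x x
  linear_combination this / 2

theorem affineCocycle_leibniz (H : LieSubalgebra ℂ g) [H.IsCartanSubalgebra]
    (x y z : LoopAlgebra g) : affineCocycle H x ⁅y, z⁆ =
      affineCocycle H ⁅x, y⁆ z + affineCocycle H y ⁅x, z⁆ := by
  induction x using TensorProduct.induction_on with
  | zero => simp
  | add x x' hx hx' => simp only [map_add, LinearMap.add_apply, add_lie, hx, hx']; ring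
  | tmul f a =>
    induction y using TensorProduct.induction_on with
    | zero => simp
    | add y y' hy hy' => simp only [map_add, LinearMap.add_apply, add_lie, lie_add, hy, hy']; ring
    | tmul f' b =>
      induction z using TensorProduct.induction_on with
      | zero => simp
      | add z z' hz hz' => simp only [map_add, lie_add, hz, hz']; ring
      | tmul f'' c =>
        rw [affineCocycle_skew H ⁅f ⊗ₜ[ℂ] a, f' ⊗ₜ[ℂ] b⁆]
        simp only [LieAlgebra.ExtendScalars.bracket_tmul, affineCocycle_tmul, ← resPairing_apply]
        have h := resPairing_cyclic f f' f''
        have e1 : normalizedForm H b ⁅a, c⁆ = -normalizedForm H a ⁅b, c⁆ := by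
          rw [← normalizedForm_lie, ← normalizedForm_lie, ← lie_skew, map_neg, LinearMap.neg_apply]
        have e2 : normalizedForm H c ⁅a, b⁆ = normalizedForm H a ⁅b, c⁆ := by
          rw [normalizedForm_symm, normalizedForm_lie]
        rw [e1, e2, mul_comm f f'']
        linear_combination normalizedForm H a ⁅b, c⁆ * h

/-- The affine Lie algebra `g ⊗ ℂ((ξ)) ⊕ ℂ c`. -/
def AffineAlgebra (H : LieSubalgebra ℂ g) [H.IsCartanSubalgebra] : Type _ := LoopAlgebra g × ℂ

variable (H : LieSubalgebra ℂ g) [H.IsCartanSubalgebra]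

instance : AddCommGroup (AffineAlgebra H) := inferInstanceAs (AddCommGroup (LoopAlgebra g × ℂ))
instance : Module ℂ (AffineAlgebra H) := inferInstanceAs (Module ℂ (LoopAlgebra g × ℂ))

instance : LieRing (AffineAlgebra H) where
  bracket x y := (⁅x.1, y.1⁆, affineCocycle H x.1 y.1)
  add_lie x y z := Prod.ext (add_lie x.1 y.1 z.1)
    (by change affineCocycle H (x.1 + y.1) z.1 = _; rw [map_add]; rfl)
  lie_add x y z := Prod.ext (lie_add x.1 y.1 z.1)
    (by change affineCocycle H x.1 (y.1 + z.1) = _; rw [map_add]; rfl)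
  lie_self x := Prod.ext (lie_self x.1) (affineCocycle_self H x.1)
  leibniz_lie x y z := Prod.ext (leibniz_lie x.1 y.1 z.1) (affineCocycle_leibniz H x.1 y.1 z.1)

instance : LieAlgebra ℂ (AffineAlgebra H) where
  lie_smul t x y := Prod.ext (lie_smul t x.1 y.1)
    (by change affineCocycle H x.1 (t • y.1) = _; rw [map_smul]; rfl)

instance : Module ℚ (AffineAlgebra H) := Module.compHom _ (algebraMap ℚ ℂ)

instance : LieAlgebra ℚ (AffineAlgebra H) where
  lie_smul t x y := lie_smul (algebraMap ℚ ℂ t) x y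

/-- The element `X ⊗ f` of the affine Lie algebra. -/
def loopElt (x : g) (f : Laurent) : AffineAlgebra H := (f ⊗ₜ[ℂ] x, 0)

/-- The central element `c`. -/
def centralElt : AffineAlgebra H := (0, 1)

theorem lie_loopElt (x y : g) (f f' : Laurent) :
    ⁅loopElt H x f, loopElt H y f'⁆ = loopElt H ⁅x, y⁆ (f * f') +
      (normalizedForm H x y * residue (f' * derivative f)) • centralElt H := by
  refine Prod.ext ?_ ?_
  · change ⁅f ⊗ₜ[ℂ] x, f' ⊗ₜ[ℂ] y⁆ = (f * f') ⊗ₜ[ℂ] ⁅x, y⁆ + _ • (0 : LoopAlgebra g)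
    rw [smul_zero, add_zero]; rfl
  · change affineCocycle H (f ⊗ₜ[ℂ] x) (f' ⊗ₜ[ℂ] y) = 0 + _ • (1 : ℂ)
    rw [affineCocycle_tmul, smul_eq_mul, mul_one, zero_add]

theorem lie_centralElt (x : AffineAlgebra H) : ⁅x, centralElt H⁆ = 0 :=
  Prod.ext (lie_zero x.1) (map_zero (affineCocycle H x.1))

/-! ### Single-shift automorphisms -/

/-- The coweight lattice: the elements of `H` on which all roots are integral. (The index runs
over the roots together with the zero weight.) -/
def coweightLattice : AddSubgroup H where
  carrier := {μ | ∀ α : LieModule.Weight ℂ H g, ∃ n : ℤ, α μ = n}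
  zero_mem' α := ⟨0, by rw [← LieModule.Weight.toLinear_apply, map_zero]; simp⟩
  add_mem' {μ ν} hμ hν α := by
    obtain ⟨m, hm⟩ := hμ α
    obtain ⟨n, hn⟩ := hν α
    exact ⟨m + n, by
      rw [← LieModule.Weight.toLinear_apply] at *; rw [map_add, hm, hn]; push_cast; rfl⟩
  neg_mem' {μ} hμ α := by
    obtain ⟨m, hm⟩ := hμ α
    exact ⟨-m, by rw [← LieModule.Weight.toLinear_apply] at *; rw [map_neg, hm]; push_cast; rfl⟩

/-- The coroot lattice. -/
def corootLattice : AddSubgroup H :=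
  AddSubgroup.closure (Set.range fun α : H.root ↦ LieAlgebra.IsKilling.coroot α.1)

/-- The integer `⟨μ, α⟩ = α(μ)` for a coweight `μ`. -/
def coweightPairing (μ : coweightLattice H) (α : LieModule.Weight ℂ H g) : ℤ :=
  (μ.2 α).choose

theorem coweightPairing_spec (μ : coweightLattice H) (α : LieModule.Weight ℂ H g) :
    α μ = coweightPairing H μ α :=
  (μ.2 α).choose_spec

open scoped Classical in
theorem bijective_rootSpace : Function.Bijective
    (DirectSum.coeLinearMap fun α : LieModule.Weight ℂ H g ↦
      (LieAlgebra.rootSpace H α).toSubmodule) := by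
  apply DirectSum.isInternal_submodule_of_iSupIndep_of_iSup_eq_top
  · exact (LieSubmodule.iSupIndep_toSubmodule).mpr (LieModule.iSupIndep_genWeightSpace' ℂ H g)
  · rw [← LieSubmodule.iSup_toSubmodule, LieModule.iSup_genWeightSpace_eq_top']
    rfl

open scoped Classical in
/-- The projection of `g` onto the root space of `α` (onto `H` for `α = 0`) along the other
summands of the root space decomposition. -/
def rootProj (α : LieModule.Weight ℂ H g) : g →ₗ[ℂ] g :=
  (LieAlgebra.rootSpace H α).toSubmodule.subtype ∘ₗ
    DirectSum.component ℂ _ (fun α : LieModule.Weight ℂ H g ↦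
      (LieAlgebra.rootSpace H α).toSubmodule) α ∘ₗ
    (LinearEquiv.ofBijective (DirectSum.coeLinearMap fun α : LieModule.Weight ℂ H g ↦
      (LieAlgebra.rootSpace H α).toSubmodule) (bijective_rootSpace H)).symm.toLinearMap

open scoped Classical in
theorem rootProj_apply_of_mem {α : LieModule.Weight ℂ H g} {x : g}
    (hx : x ∈ LieAlgebra.rootSpace H α) (β : LieModule.Weight ℂ H g) :
    rootProj H β x = if α = β then x else 0 := by
  have h : (LinearEquiv.ofBijective (DirectSum.coeLinearMap fun α : LieModule.Weight ℂ H g ↦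
      (LieAlgebra.rootSpace H α).toSubmodule) (bijective_rootSpace H)).symm x =
      DirectSum.lof ℂ _ (fun α : LieModule.Weight ℂ H g ↦
        (LieAlgebra.rootSpace H α).toSubmodule) α ⟨x, hx⟩ := by
    rw [LinearEquiv.symm_apply_eq, LinearEquiv.ofBijective_apply, DirectSum.coeLinearMap_lof]
  simp only [rootProj, LinearMap.comp_apply, LinearEquiv.coe_coe, h]
  by_cases hαβ : α = β
  · subst hαβ
    rw [if_pos rfl, DirectSum.component.lof_self]; rfl
  · rw [if_neg hαβ, DirectSum.component.of, dif_neg hαβ]; rfl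

/-- The single-shift map of the affine Lie algebra: on the root space of `α` (and on `H`, where
`α = 0`) it sends `X ⊗ f` to `X ⊗ ξ ^ ⟨μ, α⟩ f`, plus `f₀ (μ, X) c` for the constant coefficient
`f₀` of `f`, and it fixes `c`. Root vectors are orthogonal to `μ`, so the last term is present
only for `X` in `H`. -/
def singleShift (μ : coweightLattice H) : AffineAlgebra H →ₗ[ℂ] AffineAlgebra H :=
  LinearMap.prod
    ((∑ α : LieModule.Weight ℂ H g, TensorProduct.map
      (LinearMap.mulLeft ℂ (xi (coweightPairing H μ α))) (rootProj H α)) ∘ₗ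
        LinearMap.fst ℂ (LoopAlgebra g) ℂ)
    (LinearMap.snd ℂ (LoopAlgebra g) ℂ + TensorProduct.lift
      (LinearMap.smulRight (coeff 0) (normalizedForm H (μ.1 : g))) ∘ₗ
        LinearMap.fst ℂ (LoopAlgebra g) ℂ)

theorem singleShift_centralElt (μ : coweightLattice H) :
    singleShift H μ (centralElt H) = centralElt H := by
  refine Prod.ext ?_ ?_
  · exact LinearMap.map_zero (∑ α : LieModule.Weight ℂ H g, TensorProduct.map
      (LinearMap.mulLeft ℂ (xi (coweightPairing H μ α))) (rootProj H α))
  · change (1 : ℂ) + TensorProduct.lift (LinearMap.smulRight (coeff 0)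
      (normalizedForm H (μ.1 : g))) (0 : LoopAlgebra g) = 1
    rw [map_zero, add_zero]

theorem singleShift_of_mem (μ : coweightLattice H) (α : LieModule.Weight ℂ H g) {x : g}
    (hx : x ∈ LieAlgebra.rootSpace H α) (f : Laurent) :
    singleShift H μ (loopElt H x f) = loopElt H x (xi (coweightPairing H μ α) * f) +
      (coeff 0 f * normalizedForm H (μ.1 : g) x) • centralElt H := by
  classical
  refine Prod.ext ?_ ?_
  · change (∑ β : LieModule.Weight ℂ H g, TensorProduct.map
      (LinearMap.mulLeft ℂ (xi (coweightPairing H μ β))) (rootProj H β)) (f ⊗ₜ[ℂ] x) =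
        (xi (coweightPairing H μ α) * f) ⊗ₜ[ℂ] x + _ • (0 : LoopAlgebra g)
    rw [smul_zero, add_zero, LinearMap.sum_apply, Finset.sum_eq_single α]
    · rw [TensorProduct.map_tmul, rootProj_apply_of_mem H hx, if_pos rfl]; rfl
    · intro β _ hβ
      rw [TensorProduct.map_tmul, rootProj_apply_of_mem H hx, if_neg hβ.symm,
        TensorProduct.tmul_zero]
    · exact fun h ↦ absurd (Finset.mem_univ α) h
  · change (0 : ℂ) + TensorProduct.lift _ (f ⊗ₜ[ℂ] x) = 0 + _ • (1 : ℂ)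
    rw [TensorProduct.lift.tmul, smul_eq_mul, mul_one]
    rfl

theorem singleShift_cartan (μ : coweightLattice H) (h : H) (f : Laurent) :
    singleShift H μ (loopElt H h f) =
      loopElt H h f + (coeff 0 f * normalizedForm H (μ.1 : g) h) • centralElt H := by
  by_cases hh : h = 0
  · subst hh
    have e : loopElt H ((0 : H) : g) f = 0 := Prod.ext (TensorProduct.tmul_zero g f) rfl
    rw [e, map_zero]
    simp
  have h0 : (h : g) ∈ LieAlgebra.rootSpace H (0 : H → ℂ) := by
    rw [LieAlgebra.rootSpace_zero_eq]; exact h.2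
  have hne : LieAlgebra.rootSpace H (0 : H → ℂ) ≠ ⊥ := by
    intro hb
    rw [hb, LieSubmodule.mem_bot] at h0
    exact hh (Subtype.ext h0)
  let z : LieModule.Weight ℂ H g := ⟨0, hne⟩
  have hz : coweightPairing H μ z = 0 := by
    have := coweightPairing_spec H μ z
    have h2 : z μ = 0 := rfl
    rw [h2] at this
    exact_mod_cast this.symm
  rw [singleShift_of_mem H μ z h0 f, hz]
  have hx : xi 0 = 1 := rfl
  rw [hx, one_mul]

theorem singleShift_root (μ : coweightLattice H) (α : H.root) {x : g}
    (hx : x ∈ LieAlgebra.rootSpace H α.1) (f : Laurent) :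
    singleShift H μ (loopElt H x f) = loopElt H x (xi (coweightPairing H μ α.1) * f) := by
  have h0 : ((μ.1 : H) : g) ∈ LieAlgebra.rootSpace H (0 : H → ℂ) := by
    rw [LieAlgebra.rootSpace_zero_eq]; exact μ.1.2
  have hα : (0 : H → ℂ) + α.1 ≠ 0 := by
    rw [zero_add]
    simp
  have hk := LieAlgebra.killingForm_apply_eq_zero_of_mem_rootSpace_of_add_ne_zero ℂ g H h0 hx hα
  rw [singleShift_of_mem H μ α.1 hx f]
  simp [normalizedForm, hk]

/-! ### Exponentials of real root vectors on the affine Lie algebra -/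

/-- An element `X ⊗ f` of the affine Lie algebra with `X` in a root space and `f ∈ ℂ((ξ))`. -/
structure RootLoop where
  /-- The root. -/
  root : H.root
  /-- The root vector. -/
  vec : g
  mem : vec ∈ LieAlgebra.rootSpace H root.1
  /-- The Laurent series. -/
  fn : Laurent

variable {H} in
/-- The element of the affine Lie algebra. -/
def RootLoop.elt (r : RootLoop H) : AffineAlgebra H := loopElt H r.vec r.fn

variable {H} in
theorem RootLoop.root_ne (r : RootLoop H) : (r.root.1 : H → ℂ) ≠ 0 := by
  simp

variable {H} in
theorem RootLoop.isNilpotent_ad (r : RootLoop H) :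
    IsNilpotent (LieAlgebra.ad ℂ (AffineAlgebra H) r.elt) := by
  obtain ⟨k, hk⟩ := LieAlgebra.isNilpotent_ad_of_mem_rootSpace H r.root_ne r.mem
  have h1 : ∀ w : AffineAlgebra H, (LieAlgebra.ad ℂ (AffineAlgebra H) r.elt w).1 =
      TensorProduct.map (LinearMap.mulLeft ℂ r.fn) (LieAlgebra.ad ℂ g r.vec) w.1 := by
    intro w
    change ⁅r.fn ⊗ₜ[ℂ] r.vec, w.1⁆ = _
    induction w.1 using TensorProduct.induction_on with
    | zero => simp
    | add a b ha hb => rw [lie_add, map_add, ha, hb]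
    | tmul a b => rfl
  have h2 : ∀ (n : ℕ) (w : AffineAlgebra H),
      ((LieAlgebra.ad ℂ (AffineAlgebra H) r.elt ^ n) w).1 =
      TensorProduct.map (LinearMap.mulLeft ℂ r.fn ^ n) (LieAlgebra.ad ℂ g r.vec ^ n) w.1 := by
    intro n
    induction n with
    | zero => intro w; simp [Module.End.one_eq_id]
    | succ n ih =>
      intro w
      rw [pow_succ', Module.End.mul_apply, h1, ih, pow_succ', pow_succ',
        Module.End.mul_eq_comp, Module.End.mul_eq_comp, TensorProduct.map_comp,
        LinearMap.comp_apply]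
  refine ⟨k + 1, LinearMap.ext fun w ↦ ?_⟩
  have h3 : ((LieAlgebra.ad ℂ (AffineAlgebra H) r.elt ^ k) w).1 = 0 := by
    rw [h2, hk, TensorProduct.map_zero_right, LinearMap.zero_apply]
  rw [pow_succ', Module.End.mul_apply]
  change ⁅r.elt, (LieAlgebra.ad ℂ (AffineAlgebra H) r.elt ^ k) w⁆ = 0
  refine Prod.ext ?_ ?_
  · change ⁅_, ((LieAlgebra.ad ℂ (AffineAlgebra H) r.elt ^ k) w).1⁆ = 0
    rw [h3, lie_zero]
  · change affineCocycle H _ ((LieAlgebra.ad ℂ (AffineAlgebra H) r.elt ^ k) w).1 = 0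
    rw [h3, map_zero]

/-- The group of automorphisms of a complex Lie algebra. -/
def lieAut (L : Type*) [LieRing L] [LieAlgebra ℂ L] : Subgroup (L ≃ₗ[ℂ] L) where
  carrier := {e | ∀ x y, e ⁅x, y⁆ = ⁅e x, e y⁆}
  one_mem' _ _ := rfl
  mul_mem' {a b} ha hb x y := by
    rw [LinearEquiv.mul_apply, hb, ha]; rfl
  inv_mem' {a} ha x y := by
    apply a.injective
    rw [ha]
    change a (a.symm _) = ⁅a (a.symm x), a (a.symm y)⁆
    simp only [LinearEquiv.apply_symm_apply]

variable {H} in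
theorem RootLoop.isNilpotent_adDerivation (r : RootLoop H) :
    IsNilpotent (LieDerivation.ad ℂ (AffineAlgebra H) r.elt).toLinearMap := by
  have h : (LieDerivation.ad ℂ (AffineAlgebra H) r.elt).toLinearMap =
      LieAlgebra.ad ℂ (AffineAlgebra H) r.elt := LinearMap.ext fun w ↦ LieDerivation.ad_apply_apply ℂ _ _ w
  rw [h]
  exact r.isNilpotent_ad

variable {H} in
/-- The automorphism `exp (ad (X ⊗ f))` of the affine Lie algebra. -/
def RootLoop.expAd (r : RootLoop H) : lieAut (AffineAlgebra H) :=
  ⟨(LieDerivation.exp (LieDerivation.ad ℂ (AffineAlgebra H) r.elt)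
    r.isNilpotent_adDerivation).toLinearEquiv, fun x y ↦ LieEquiv.map_lie _ x y⟩

end Affine

/-! ### The group `G` and its points over `ℂ((ξ))` -/

section Group

variable {g : Type*} [LieRing g] [LieAlgebra ℂ g]
  {ι : Type*} [Fintype ι] [DecidableEq ι] (ρ : g →ₗ⁅ℂ⁆ Matrix ι ι ℂ)

/-- The connected Lie subgroup of `GL(N, ℂ)` with Lie algebra `ρ(g)`: it is generated by the
matrices `exp (ρ x)`, `x ∈ g`. -/
def complexGroup : Subgroup (Matrix.GeneralLinearGroup ι ℂ) :=
  Subgroup.closure {a | ∃ x : g, (a : Matrix ι ι ℂ) = NormedSpace.exp (ρ x)}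

/-- The index type of the coordinates of `GL(N)`: the entries of a matrix and of its inverse. -/
abbrev Coord (ι : Type*) : Type _ := (ι × ι) ⊕ (ι × ι)

/-- The coordinates of an invertible matrix: its entries and those of its inverse. -/
def glCoord {A : Type*} [CommRing A] (a : Matrix.GeneralLinearGroup ι A) : Coord ι → A :=
  Sum.elim (fun p ↦ (a : Matrix ι ι A) p.1 p.2) fun p ↦ (↑a⁻¹ : Matrix ι ι A) p.1 p.2

/-- A polynomial over `ℂ` in the coordinates of `GL(N)` that vanishes on `G`. -/
def VanishesOnGroup (P : MvPolynomial (Coord ι) ℂ) : Prop :=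
  ∀ b ∈ complexGroup ρ, MvPolynomial.aeval (glCoord b) P = 0

/-- The condition on a matrix over `ℂ((ξ))` to be a point of `G`: the polynomial equations of `G`
hold for it. -/
def IsLoopPoint (a : Matrix.GeneralLinearGroup ι Laurent) : Prop :=
  ∀ P, VanishesOnGroup ρ P → MvPolynomial.aeval (glCoord a) P = 0

theorem aeval_eq_zero_of_isLoopPoint {a : Matrix.GeneralLinearGroup ι Laurent}
    (ha : IsLoopPoint ρ a) (R : MvPolynomial (Coord ι) Laurent)
    (hR : ∀ b ∈ complexGroup ρ,
      MvPolynomial.eval (fun i ↦ algebraMap ℂ Laurent (glCoord b i)) R = 0) :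
    MvPolynomial.eval (glCoord a) R = 0 := by
  classical
  let B := Module.Basis.ofVectorSpace ℂ Laurent
  let T := R.support.biUnion fun m ↦ (B.repr (R.coeff m)).support
  let Q : _ → MvPolynomial (Coord ι) ℂ := fun i ↦
    ∑ m ∈ R.support, MvPolynomial.monomial m (B.repr (R.coeff m) i)
  have hc : ∀ m ∈ R.support, R.coeff m = ∑ i ∈ T, (B.repr (R.coeff m) i) • B i := by
    intro m hm
    conv_lhs => rw [← B.linearCombination_repr (R.coeff m)]
    rw [Finsupp.linearCombination_apply, Finsupp.sum]
    refine Finset.sum_subset (Finset.subset_biUnion_of_mem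
      (fun m ↦ (B.repr (R.coeff m)).support) hm) fun i _ hi ↦ ?_
    rw [Finsupp.notMem_support_iff.mp hi, zero_smul]
  have hev : ∀ v : Coord ι → Laurent, MvPolynomial.eval v R =
      ∑ i ∈ T, MvPolynomial.aeval v (Q i) * B i := by
    intro v
    rw [MvPolynomial.eval_eq]
    simp only [Q, map_sum, MvPolynomial.aeval_monomial, Finset.sum_mul]
    rw [Finset.sum_comm]
    refine Finset.sum_congr rfl fun m hm ↦ ?_
    conv_lhs => rw [hc m hm]
    rw [Finset.sum_mul]
    refine Finset.sum_congr rfl fun i _ ↦ ?_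
    rw [Algebra.smul_def, Finsupp.prod_fintype _ _ (fun i ↦ pow_zero _), mul_right_comm]
    congr 2
    exact Finset.prod_subset (Finset.subset_univ _) fun j _ hj ↦ by
      rw [Finsupp.notMem_support_iff.mp hj, pow_zero]
  have hQ : ∀ i ∈ T, VanishesOnGroup ρ (Q i) := by
    intro i hi b hb
    have h := hR b hb
    rw [hev] at h
    have h2 : ∀ j, MvPolynomial.aeval (fun i ↦ algebraMap ℂ Laurent (glCoord b i)) (Q j) =
        algebraMap ℂ Laurent (MvPolynomial.aeval (glCoord b) (Q j)) := fun j ↦ by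
      exact MvPolynomial.aeval_algebraMap_apply Laurent (glCoord b) (Q j)
    simp only [h2, ← Algebra.smul_def] at h
    exact linearIndependent_iff'.mp B.linearIndependent T _ h i hi
  rw [hev]
  exact Finset.sum_eq_zero fun i hi ↦ by rw [ha _ (hQ i hi), zero_mul]

/-- The polynomials that express the coordinates of a product. -/
def mulPoly : Coord ι → MvPolynomial (Coord ι ⊕ Coord ι) ℂ :=
  Sum.elim
    (fun p ↦ ∑ k, MvPolynomial.X (.inl (.inl (p.1, k))) * MvPolynomial.X (.inr (.inl (k, p.2))))
    (fun p ↦ ∑ k, MvPolynomial.X (.inr (.inr (p.1, k))) * MvPolynomial.X (.inl (.inr (k, p.2))))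

theorem aeval_mulPoly {A : Type*} [CommRing A] [Algebra ℂ A]
    (a b : Matrix.GeneralLinearGroup ι A) (i : Coord ι) :
    MvPolynomial.aeval (Sum.elim (glCoord a) (glCoord b)) (mulPoly i) = glCoord (a * b) i := by
  rcases i with p | p
  · simp [mulPoly, glCoord, Matrix.mul_apply]
  · simp [mulPoly, glCoord, Matrix.mul_apply, mul_inv_rev, -Matrix.coe_units_inv]

theorem IsLoopPoint.mul {a b : Matrix.GeneralLinearGroup ι Laurent} (ha : IsLoopPoint ρ a)
    (hb : IsLoopPoint ρ b) : IsLoopPoint ρ (a * b) := by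
  intro P hP
  let Q : MvPolynomial (Coord ι ⊕ Coord ι) ℂ := MvPolynomial.aeval mulPoly P
  have hQ : ∀ {A : Type} [CommRing A] [Algebra ℂ A] (c d : Matrix.GeneralLinearGroup ι A),
      MvPolynomial.aeval (Sum.elim (glCoord c) (glCoord d)) Q =
        MvPolynomial.aeval (glCoord (c * d)) P := by
    intro A _ _ c d
    rw [← AlgHom.comp_apply, MvPolynomial.comp_aeval]
    congr 1
    congr 1
    funext i
    exact aeval_mulPoly c d i
  have step1 : ∀ c ∈ complexGroup ρ, MvPolynomial.aeval
      (Sum.elim (fun i ↦ algebraMap ℂ Laurent (glCoord c i)) (glCoord b)) Q = 0 := by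
    intro c hc
    let Qc : MvPolynomial (Coord ι) ℂ := MvPolynomial.aeval
      (Sum.elim (fun i ↦ MvPolynomial.C (glCoord c i)) MvPolynomial.X) Q
    have h1 : ∀ {A : Type} [CommRing A] [Algebra ℂ A] (v : Coord ι → A),
        MvPolynomial.aeval v Qc =
          MvPolynomial.aeval (Sum.elim (fun i ↦ algebraMap ℂ A (glCoord c i)) v) Q := by
      intro A _ _ v
      rw [← AlgHom.comp_apply, MvPolynomial.comp_aeval]
      congr 1
      congr 1
      funext i
      rcases i with i | i
      · simp
      · simp
    rw [← h1]
    refine hb Qc fun d hd ↦ ?_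
    rw [h1]
    exact (hQ c d).trans (hP _ (mul_mem hc hd))
  let R : MvPolynomial (Coord ι) Laurent := MvPolynomial.aeval
    (Sum.elim MvPolynomial.X (fun i ↦ MvPolynomial.C (glCoord b i))) Q
  have h2 : ∀ v : Coord ι → Laurent, MvPolynomial.eval v R =
      MvPolynomial.aeval (Sum.elim v (glCoord b)) Q := by
    intro v
    have : MvPolynomial.eval v R =
      ((MvPolynomial.aeval v : MvPolynomial (Coord ι) Laurent →ₐ[Laurent] Laurent).restrictScalars
        ℂ) R := by
      rw [AlgHom.restrictScalars_apply, MvPolynomial.aeval_eq_eval]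
    rw [this, ← AlgHom.comp_apply, MvPolynomial.comp_aeval]
    congr 1
    congr 1
    funext i
    rcases i with i | i
    · simp
    · simp
  rw [← hQ, ← h2]
  refine aeval_eq_zero_of_isLoopPoint ρ ha R fun c hc ↦ ?_
  rw [h2]
  exact step1 c hc

theorem IsLoopPoint.inv {a : Matrix.GeneralLinearGroup ι Laurent} (ha : IsLoopPoint ρ a) :
    IsLoopPoint ρ a⁻¹ := by
  intro P hP
  have h : ∀ {A : Type} [CommRing A] [Algebra ℂ A] (c : Matrix.GeneralLinearGroup ι A),
      MvPolynomial.aeval (glCoord c) (MvPolynomial.rename Sum.swap P) =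
        MvPolynomial.aeval (glCoord c⁻¹) P := by
    intro A _ _ c
    rw [MvPolynomial.aeval_rename]
    congr 1
    congr 1
    funext i
    rcases i with i | i
    · rfl
    · simp only [Function.comp_apply, glCoord, Sum.swap_inr, Sum.elim_inl, Sum.elim_inr, inv_inv]
  rw [← h]
  exact ha _ fun b hb ↦ (h b).trans (hP _ (inv_mem hb))

theorem IsLoopPoint.one : IsLoopPoint ρ (1 : Matrix.GeneralLinearGroup ι Laurent) := by
  intro P hP
  have h : glCoord (1 : Matrix.GeneralLinearGroup ι Laurent) =
      fun i ↦ algebraMap ℂ Laurent (glCoord (1 : Matrix.GeneralLinearGroup ι ℂ) i) := by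
    funext i
    rcases i with i | i <;> simp [glCoord, Matrix.one_apply, apply_ite (algebraMap ℂ Laurent)]
  have h2 := MvPolynomial.aeval_algebraMap_apply Laurent
    (glCoord (1 : Matrix.GeneralLinearGroup ι ℂ)) P
  rw [hP 1 (one_mem _), map_zero] at h2
  rw [h]
  exact h2

/-- The group `G(ℂ((ξ)))` of `ℂ((ξ))`-points of the algebraic group `G`. -/
def loopGroup : Subgroup (Matrix.GeneralLinearGroup ι Laurent) where
  carrier := {a | IsLoopPoint ρ a}
  one_mem' := IsLoopPoint.one ρ
  mul_mem' ha hb := IsLoopPoint.mul ρ ha hb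
  inv_mem' ha := IsLoopPoint.inv ρ ha

/-! ### One-parameter subgroups of root vectors in `G(ℂ((ξ)))` -/

theorem exp_smul_map_eq {A : Type} [CommRing A] [Algebra ℂ A] [Algebra ℚ A]
    {N : Matrix ι ι ℂ} {k : ℕ} (hN : N ^ k = 0) (t : A) (i j : ι) :
    (IsNilpotent.exp (t • N.map (algebraMap ℂ A))) i j =
      Polynomial.aeval t (∑ l ∈ Finset.range k,
        Polynomial.monomial l ((l.factorial : ℂ)⁻¹ * (N ^ l) i j)) := by
  have hmap : ∀ l, (N.map (algebraMap ℂ A)) ^ l = (N ^ l).map (algebraMap ℂ A) := fun l ↦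
    (map_pow (RingHom.mapMatrix (m := ι) (algebraMap ℂ A)) N l).symm
  have h0 : (t • N.map (algebraMap ℂ A)) ^ k = 0 := by
    rw [smul_pow, hmap, hN]; simp
  rw [IsNilpotent.exp_eq_sum h0, map_sum, Matrix.sum_apply]
  refine Finset.sum_congr rfl fun l _ ↦ ?_
  rw [smul_pow, hmap, Matrix.smul_apply, Matrix.smul_apply, Matrix.map_apply,
    Polynomial.aeval_monomial, map_mul, smul_eq_mul, Algebra.smul_def]
  have hq : algebraMap ℚ A ((l.factorial : ℚ)⁻¹) = algebraMap ℂ A ((l.factorial : ℂ)⁻¹) := by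
    have : algebraMap ℚ A = (algebraMap ℂ A).comp (algebraMap ℚ ℂ) := Subsingleton.elim _ _
    rw [this]; simp
  rw [hq]
  ring

theorem normedSpaceExp_eq_nilpotentExp {N : Matrix ι ι ℂ} (hN : IsNilpotent N) :
    NormedSpace.exp N = IsNilpotent.exp N := by
  obtain ⟨k, hk⟩ := hN
  rw [NormedSpace.exp_eq_tsum ℚ, IsNilpotent.exp_eq_sum hk]
  refine tsum_eq_sum fun n hn ↦ ?_
  rw [Finset.mem_range, not_lt] at hn
  rw [pow_eq_zero_of_le hn hk, smul_zero]

/-- The invertible matrix `exp (f N)` over `ℂ((ξ))`, for `N` nilpotent. -/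
def expUnit (N : Matrix ι ι ℂ) (hN : IsNilpotent N) (f : Laurent) :
    Matrix.GeneralLinearGroup ι Laurent where
  val := IsNilpotent.exp (f • N.map (algebraMap ℂ Laurent))
  inv := IsNilpotent.exp (-(f • N.map (algebraMap ℂ Laurent)))
  val_inv := IsNilpotent.exp_mul_exp_neg_self
    (((hN.map (RingHom.mapMatrix (m := ι) (algebraMap ℂ Laurent)))).smul f)
  inv_val := IsNilpotent.exp_neg_mul_exp_self
    (((hN.map (RingHom.mapMatrix (m := ι) (algebraMap ℂ Laurent)))).smul f)

theorem expUnit_mem (x : g) (hN : IsNilpotent (ρ x)) (f : Laurent) :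
    expUnit (ρ x) hN f ∈ loopGroup ρ := by
  intro P hP
  obtain ⟨k, hk⟩ := id hN
  let T : ι → ι → Polynomial ℂ := fun i j ↦ ∑ l ∈ Finset.range k,
    Polynomial.monomial l ((l.factorial : ℂ)⁻¹ * ((ρ x) ^ l) i j)
  let u : Coord ι → Polynomial ℂ := Sum.elim (fun p ↦ T p.1 p.2)
    fun p ↦ (T p.1 p.2).comp (-Polynomial.X)
  have hT : ∀ {A : Type} [CommRing A] [Algebra ℂ A] [Algebra ℚ A] (t : A) (i j : ι),
      (IsNilpotent.exp (t • (ρ x).map (algebraMap ℂ A))) i j = Polynomial.aeval t (T i j) :=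
    fun t i j ↦ exp_smul_map_eq hk t i j
  have hT' : ∀ {A : Type} [CommRing A] [Algebra ℂ A] [Algebra ℚ A] (t : A) (i j : ι),
      (IsNilpotent.exp (-(t • (ρ x).map (algebraMap ℂ A)))) i j =
        Polynomial.aeval t ((T i j).comp (-Polynomial.X)) := by
    intro A _ _ _ t i j
    rw [← neg_smul, hT, Polynomial.aeval_comp]
    simp
  have hf : glCoord (expUnit (ρ x) hN f) = fun i ↦ Polynomial.aeval f (u i) := by
    funext i
    rcases i with i | i
    · exact hT f i.1 i.2
    · exact hT' f i.1 i.2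
  have hp : MvPolynomial.aeval u P = 0 := by
    apply Polynomial.funext
    intro s
    have hs : IsNilpotent (s • ρ x) := hN.smul s
    let b : Matrix.GeneralLinearGroup ι ℂ := ⟨IsNilpotent.exp (s • ρ x),
      IsNilpotent.exp (-(s • ρ x)), IsNilpotent.exp_mul_exp_neg_self hs,
      IsNilpotent.exp_neg_mul_exp_self hs⟩
    have hb : b ∈ complexGroup ρ := Subgroup.subset_closure
      ⟨s • x, by rw [map_smul, normedSpaceExp_eq_nilpotentExp hs]⟩
    have hid : (ρ x).map (algebraMap ℂ ℂ) = ρ x := by ext; simp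
    have hbc : glCoord b = fun i ↦ Polynomial.aeval s (u i) := by
      funext i
      rcases i with i | i
      · have := hT s i.1 i.2
        rw [hid] at this
        exact this
      · have := hT' s i.1 i.2
        rw [hid] at this
        exact this
    have := hP b hb
    rw [hbc] at this
    rw [Polynomial.eval_zero, ← Polynomial.coe_aeval_eq_eval, ← this]
    change (Polynomial.aeval s) ((MvPolynomial.aeval u) P) = _
    rw [← AlgHom.comp_apply, MvPolynomial.comp_aeval]
  rw [hf]
  have h2 : MvPolynomial.aeval (fun i ↦ Polynomial.aeval f (u i)) P =
      Polynomial.aeval f (MvPolynomial.aeval u P) := by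
    rw [← AlgHom.comp_apply, MvPolynomial.comp_aeval]
  rw [h2, hp, map_zero]

/-- The matrix `τ` over `ℂ((ξ))` is `exp (ln ξ · ρ(μ))`: the one-parameter subgroup
`exp s ↦ exp (s ρ(μ))` is a Laurent polynomial `∑ Aₙ tⁿ` in `t = exp s`, and `τ` is its value at
`t = ξ`. -/
def IsExpLog (μ : g) (τ : Matrix ι ι Laurent) : Prop :=
  ∃ A : ℤ →₀ Matrix ι ι ℂ,
    (∀ s : ℂ, NormedSpace.exp (s • ρ μ) = A.sum fun n M ↦ Complex.exp (s * n) • M) ∧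
    τ = A.sum fun n M ↦ xi n • M.map (algebraMap ℂ Laurent)

end Group

/-! ### The Kac–Moody group -/

section KacMoody

variable {g : Type*} [LieRing g] [LieAlgebra ℂ g] [FiniteDimensional ℂ g]
  [LieAlgebra.IsKilling ℂ g] (H : LieSubalgebra ℂ g) [H.IsCartanSubalgebra]
  {ι : Type*} [Fintype ι] [DecidableEq ι] (ρ : g →ₗ⁅ℂ⁆ Matrix ι ι ℂ)

variable {H} in
theorem RootLoop.isNilpotent_rep (r : RootLoop H) : IsNilpotent (ρ r.vec) := by
  let φ : g →ₗ⁅ℂ⁆ Module.End ℂ (ι → ℂ) :=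
    (lieEquivMatrix' (R := ℂ) (n := ι)).symm.toLieHom.comp ρ
  let _ : LieRingModule g (ι → ℂ) := LieRingModule.compLieHom (ι → ℂ) φ
  let _ : LieModule ℂ g (ι → ℂ) := LieModule.compLieHom (ι → ℂ) φ
  have h := LieModule.isNilpotent_toEnd_of_mem_rootSpace (M := ι → ℂ) H r.root_ne r.mem
  have e : LieModule.toEnd ℂ g (ι → ℂ) r.vec = Matrix.toLinAlgEquiv' (ρ r.vec) := rfl
  rw [e] at h
  exact (IsNilpotent.map_iff (Matrix.toLinAlgEquiv' (R := ℂ) (n := ι)).injective).mp h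

variable {H} in
/-- The point `exp (f ρ(X))` of `G(ℂ((ξ)))`. -/
def RootLoop.expLoop (r : RootLoop H) : loopGroup ρ :=
  ⟨expUnit (ρ r.vec) (r.isNilpotent_rep ρ) r.fn, expUnit_mem ρ r.vec _ r.fn⟩

/-- A module over the affine Lie algebra is smooth if each vector is killed by
`ξ ^ N g[[ξ]]` for some `N`, and integrable if all `X ⊗ f` with `X` a root vector act locally
nilpotently. -/
structure IsSmoothIntegrable (M : Type*) [AddCommGroup M] [Module ℂ M]
    [LieRingModule (AffineAlgebra H) M] [LieModule ℂ (AffineAlgebra H) M] : Prop where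
  smooth : ∀ v : M, ∃ N : ℕ, ∀ (x : g) (f : PowerSeries ℂ),
    ⁅loopElt H x (xi N * ofPowerSeries f), v⁆ = 0
  integrable : ∀ (r : RootLoop H) (v : M), ∃ n : ℕ,
    (LieModule.toEnd ℂ (AffineAlgebra H) M r.elt ^ n) v = 0

/-- The free group on the symbols `exp (X ⊗ f)`, with `X` a root vector and `f ∈ ℂ((ξ))`. -/
abbrev FreeExp : Type _ := FreeGroup (RootLoop H)

/-- The action of the free group on `M` in which the symbol `exp (X ⊗ f)` acts as the exponential
series of `X ⊗ f` (a finite sum on each vector). -/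
def IsExponentiated (M : Type*) [AddCommGroup M] [Module ℂ M]
    [LieRingModule (AffineAlgebra H) M] [LieModule ℂ (AffineAlgebra H) M]
    (φ : FreeExp H →* (M ≃ₗ[ℂ] M)) : Prop :=
  ∀ (r : RootLoop H) (v : M) (n : ℕ), (LieModule.toEnd ℂ (AffineAlgebra H) M r.elt ^ n) v = 0 →
    φ (FreeGroup.of r) v = ∑ k ∈ Finset.range n,
      (k.factorial : ℂ)⁻¹ • (LieModule.toEnd ℂ (AffineAlgebra H) M r.elt ^ k) v

/-- The map of the free group to `G(ℂ((ξ)))`. -/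
def freeToLoop : FreeExp H →* loopGroup ρ := FreeGroup.lift fun r ↦ r.expLoop ρ

/-- The adjoint action of the free group on the affine Lie algebra. -/
def freeAd : FreeExp H →* lieAut (AffineAlgebra H) := FreeGroup.lift fun r ↦ r.expAd

/-- The words that act trivially in all smooth integrable modules, in the adjoint representation
and in `G(ℂ((ξ)))`. -/
def kacMoodyRel : Subgroup (FreeExp H) where
  carrier := {w | freeToLoop H ρ w = 1 ∧ freeAd H w = 1 ∧
    ∀ (M : Type) [AddCommGroup M] [Module ℂ M] [LieRingModule (AffineAlgebra H) M]
      [LieModule ℂ (AffineAlgebra H) M], IsSmoothIntegrable H M →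
      ∀ φ : FreeExp H →* (M ≃ₗ[ℂ] M), IsExponentiated H M φ → φ w = 1}
  one_mem' := ⟨map_one _, map_one _, fun _ _ _ _ _ _ φ _ ↦ map_one φ⟩
  mul_mem' := by
    rintro a b ⟨ha1, ha2, ha3⟩ ⟨hb1, hb2, hb3⟩
    exact ⟨by rw [map_mul, ha1, hb1, one_mul], by rw [map_mul, ha2, hb2, one_mul],
      fun M _ _ _ _ hM φ hφ ↦ by rw [map_mul, ha3 M hM φ hφ, hb3 M hM φ hφ, one_mul]⟩
  inv_mem' := by
    rintro a ⟨ha1, ha2, ha3⟩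
    exact ⟨by rw [map_inv, ha1, inv_one], by rw [map_inv, ha2, inv_one],
      fun M _ _ _ _ hM φ hφ ↦ by rw [map_inv, ha3 M hM φ hφ, inv_one]⟩

instance : (kacMoodyRel H ρ).Normal where
  conj_mem := by
    rintro a ⟨ha1, ha2, ha3⟩ w
    exact ⟨by simp [ha1], by simp [ha2], fun M _ _ _ _ hM φ hφ ↦ by simp [ha3 M hM φ hφ]⟩

/-- The Kac–Moody group: the group generated by the one-parameter subgroups `exp (X ⊗ f)` of the
affine Lie algebra, modulo the words that act trivially in its integrable representations. It is
the central extension of `G(ℂ((ξ)))` that acts on the integrable modules of the affine Lie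
algebra. -/
abbrev KacMoodyGroup : Type _ := FreeExp H ⧸ kacMoodyRel H ρ

/-- The projection of the Kac–Moody group to `G(ℂ((ξ)))`. -/
def KacMoodyGroup.toLoop : KacMoodyGroup H ρ →* loopGroup ρ :=
  QuotientGroup.lift (kacMoodyRel H ρ) (freeToLoop H ρ) fun _ hw ↦ hw.1

/-- The adjoint representation of the Kac–Moody group on the affine Lie algebra. -/
def KacMoodyGroup.Ad : KacMoodyGroup H ρ →* lieAut (AffineAlgebra H) :=
  QuotientGroup.lift (kacMoodyRel H ρ) (freeAd H) fun _ hw ↦ hw.2.1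

end KacMoody

/-- A classical Lie algebra, i.e. of type `A`, `B`, `C` or `D`. -/
def IsClassical (g : Type*) [LieRing g] [LieAlgebra ℂ g] : Prop :=
  ∃ n : ℕ, Nonempty (g ≃ₗ⁅ℂ⁆ LieAlgebra.SpecialLinear.sl (Fin n) ℂ) ∨
    Nonempty (g ≃ₗ⁅ℂ⁆ LieAlgebra.Orthogonal.so (Fin n) ℂ) ∨
    Nonempty (g ≃ₗ⁅ℂ⁆ LieAlgebra.Symplectic.sp (Fin n) ℂ)

end SingleShift

end

open SingleShift

/-! Write `t = exp s`. For an `sl₂`-triple `(h, e, f)` the coroot subgroup factors as `exp (s h) =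
exp (t e) exp (-t⁻¹ f) exp (t e) · exp (-e) exp f exp (-e)`, the `SL₂` identity
`exp_smul_eq_weylElement`. Every factor is the exponential of a root vector times a monomial in `t`,
so putting `t = ξ` turns the right side into a word in the generators of the Kac–Moody group.
Coroots generate `Q^∨` and their one-parameter subgroups commute, so concatenating such words gives
a lift of `τ_μ` for each `μ` in `Q^∨` (`exists_isExpLog`). The substitution `t = ξ` is unambiguous
because the functions `exp (n s)` are linearly independent (`IsLaurentValue.unique`).

Modulo the centre, the adjoint action of a word is conjugation by its matrix over `ℂ((ξ))`, seen
through the faithful representation `X ⊗ f ↦ f ρ(X)` (`affineRep_freeAd`). Conjugation by `τ_μ`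
multiplies `g_α` by `ξ ^ α(μ)`, so `Ad` of a lift and `σ_μ` agree modulo `c`.

The central terms need no computation with the word. Both maps respect brackets (`singleShift_lie`
for `σ_μ`), a bracket does not see central summands of its arguments, and every `X ⊗ f` is a sum of
brackets because `g` is perfect. Hence two such maps that agree modulo `c` agree on all `X ⊗ f`;
both fix `c`. The argument uses only the image of the word in `G(ℂ((ξ)))`, so it covers all lifts.
-/

noncomputable section

namespace SingleShift

/-! ### Exponentials of an `sl₂`-triple in a Banach algebra -/

section BanachAlgebra

open NormedSpace (exp)

variable {𝔸 : Type*} [NormedRing 𝔸] [NormedAlgebra ℂ 𝔸] [CompleteSpace 𝔸]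

theorem exp_add_of_commute {x y : 𝔸} (h : Commute x y) : exp (x + y) = exp x * exp y :=
  let _ : NormedAlgebra ℚ 𝔸 := NormedAlgebra.restrictScalars ℚ ℂ 𝔸
  NormedSpace.exp_add_of_commute h

theorem exp_mul_exp_neg (x : 𝔸) : exp x * exp (-x) = 1 := by
  rw [← exp_add_of_commute (Commute.neg_right rfl), add_neg_cancel, NormedSpace.exp_zero]

theorem exp_neg_mul_exp (x : 𝔸) : exp (-x) * exp x = 1 := by
  rw [← exp_add_of_commute (Commute.neg_left rfl), neg_add_cancel, NormedSpace.exp_zero]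

theorem hasDerivAt_exp_neg_smul (x : 𝔸) (t : ℂ) :
    HasDerivAt (fun u : ℂ ↦ exp (-(u • x))) (-(exp (-(t • x)) * x)) t := by
  have := hasDerivAt_exp_smul_const (𝕂 := ℂ) (-x) t
  simpa only [smul_neg, mul_neg] using this

/-- A solution of `y' = [x, y]` is conjugated by `exp (t x)`. -/
theorem exp_smul_mul_eq_of_hasDerivAt {x : 𝔸} {y : ℂ → 𝔸}
    (hy : ∀ t, HasDerivAt y (x * y t - y t * x) t) (t : ℂ) :
    exp (t • x) * y 0 = y t * exp (t • x) := by
  have hd : ∀ t, HasDerivAt (fun u : ℂ ↦ exp (-(u • x)) * y u * exp (u • x)) 0 t := by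
    intro t
    refine (((hasDerivAt_exp_neg_smul x t).mul (hy t)).mul
      (hasDerivAt_exp_smul_const' (𝕂 := ℂ) x t)).congr_deriv ?_
    rw [Pi.mul_apply]
    noncomm_ring
  have hc := is_const_of_deriv_eq_zero (fun t ↦ (hd t).differentiableAt) (fun t ↦ (hd t).deriv) t 0
  simp only [zero_smul, neg_zero, NormedSpace.exp_zero, one_mul, mul_one] at hc
  rw [← hc, ← mul_assoc, ← mul_assoc, exp_mul_exp_neg, one_mul]

/-- An eigenvector of `ad x` is an eigenvector of the conjugation by `exp (t x)`. -/
theorem exp_smul_mul_eq_of_eigenvector {x y : 𝔸} {a : ℂ} (h : x * y - y * x = a • y) (t : ℂ) :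
    exp (t • x) * y = (Complex.exp (t * a) • y) * exp (t • x) := by
  have := exp_smul_mul_eq_of_hasDerivAt (x := x) (y := fun t ↦ Complex.exp (t * a) • y) (fun t ↦ by
    refine (((hasDerivAt_mul_const a).cexp).smul_const y).congr_deriv ?_
    rw [mul_smul_comm, smul_mul_assoc, ← smul_sub, h, smul_smul]) t
  simpa using this

variable {h e f : 𝔸}

/-- The curve `h - 2te` solves `y' = [e, y]`. This and the next two lemmas give the adjoint action
of the root subgroups of `SL₂`, where the exponential series of `ad` breaks off. -/
theorem exp_smul_e_mul_h (hhe : h * e - e * h = 2 • e) (t : ℂ) :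
    exp (t • e) * h = (h - (2 * t) • e) * exp (t • e) := by
  have := exp_smul_mul_eq_of_hasDerivAt (x := e) (y := fun t ↦ h - (2 * t) • e) (fun t ↦ by
    have h1 : HasDerivAt (fun t : ℂ ↦ h - (2 * t) • e) (-(((2 : ℂ) * 1) • e)) t :=
      (((hasDerivAt_id t).const_mul (2 : ℂ)).smul_const e).const_sub h
    refine h1.congr_deriv ?_
    rw [mul_sub, sub_mul, mul_smul_comm, smul_mul_assoc, sub_sub_sub_cancel_right,
      ← neg_sub, hhe, mul_one, two_smul, two_nsmul]) t
  simpa using this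

theorem exp_smul_e_mul_f (hef : e * f - f * e = h) (hhe : h * e - e * h = 2 • e) (t : ℂ) :
    exp (t • e) * f = (f + t • h - (t ^ 2) • e) * exp (t • e) := by
  have := exp_smul_mul_eq_of_hasDerivAt (x := e) (y := fun t ↦ f + t • h - (t ^ 2) • e) (fun t ↦ by
    have h1 : HasDerivAt (fun t : ℂ ↦ f + t • h - (t ^ 2) • e)
        ((1 : ℂ) • h - ((2 : ℕ) * t ^ 1 * 1 : ℂ) • e) t :=
      (((hasDerivAt_id t).smul_const h).const_add f).sub
        (((hasDerivAt_id t).pow 2).smul_const e)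
    refine h1.congr_deriv ?_
    have h2 : e * h = h * e - 2 • e := by rw [← hhe]; abel
    have h3 : e * f = h + f * e := by rw [← hef]; abel
    simp only [mul_sub, sub_mul, mul_add, add_mul, mul_smul_comm, smul_mul_assoc, h2, h3]
    module) t
  simpa using this

/-- Exchanging `e` and `f` and negating `h` gives another `sl₂`-triple. -/
theorem exp_smul_f_mul_e (hef : e * f - f * e = h) (hhf : h * f - f * h = -(2 • f)) (t : ℂ) :
    exp (t • f) * e = (e - t • h - (t ^ 2) • f) * exp (t • f) := by
  have := exp_smul_e_mul_f (e := f) (f := e) (h := -h) (by rw [← hef]; abel)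
    (by rw [neg_mul, mul_neg, sub_neg_eq_add, neg_add_eq_sub, ← neg_sub, hhf, neg_neg]) t
  rw [this, smul_neg, ← sub_eq_add_neg]

/-- The product `exp (t e) exp (-u f) exp (t e)`, which for `u = t⁻¹` represents the nontrivial
Weyl group element of `SL₂`. -/
def weylElement (e f : 𝔸) (t u : ℂ) : 𝔸 := exp (t • e) * exp (-u • f) * exp (t • e)

/-- The Weyl element exchanges the two root spaces. The inner `exp (t e)` fixes `e`, then `exp (-u
f)` sends it to `e + u h - u² f`, and in the image of this under the outer `exp (t e)` all terms but
`-u² f` cancel, since `t u = 1`. -/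
theorem weylElement_mul (hef : e * f - f * e = h) (hhe : h * e - e * h = 2 • e)
    (hhf : h * f - f * h = -(2 • f)) {t u : ℂ} (htu : t * u = 1) :
    weylElement e f t u * e = (-(u ^ 2) • f) * weylElement e f t u := by
  have h1 : exp (t • e) * e = e * exp (t • e) := by
    simpa using exp_smul_mul_eq_of_hasDerivAt (x := e) (y := fun _ ↦ e)
      (fun t ↦ by simpa using hasDerivAt_const t e) t
  have h2 := exp_smul_f_mul_e hef hhf (-u)
  have h3 := exp_smul_e_mul_f hef hhe t
  have h4 := exp_smul_e_mul_h hhe t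
  have h5 : exp (t • e) * (e - (-u) • h - ((-u) ^ 2) • f) = (-(u ^ 2) • f) * exp (t • e) := by
    rw [mul_sub, mul_sub, mul_smul_comm, mul_smul_comm, h1, h3, h4, ← smul_mul_assoc,
      ← smul_mul_assoc, ← sub_mul, ← sub_mul]
    congr 1
    have e1 : u * t = 1 := by rw [mul_comm]; exact htu
    have e2 : u ^ 2 * t = u := by linear_combination u * e1
    have e3 : u ^ 2 * t ^ 2 = 1 := by linear_combination (u * t + 1) * e1
    simp only [smul_sub, smul_add, smul_smul, neg_sq, e2, e3]
    rw [show -u * (2 * t) = -2 by linear_combination -2 * e1]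
    module
  rw [weylElement, mul_assoc, h1, ← mul_assoc, mul_assoc _ _ e, h2, ← mul_assoc, h5]
  simp only [mul_assoc]

/-- The one-parameter subgroup of the coroot of `SL₂` is a Laurent polynomial in `exp s`. -/
theorem exp_smul_eq_weylElement (hef : e * f - f * e = h) (hhe : h * e - e * h = 2 • e)
    (hhf : h * f - f * h = -(2 • f)) (s : ℂ) :
    exp (s • h) = weylElement e f (Complex.exp s) (Complex.exp (-s)) *
      (exp (-e) * exp f * exp (-e)) := by
  set t : ℂ → ℂ := Complex.exp
  set u : ℂ → ℂ := fun s ↦ Complex.exp (-s)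
  have htu : ∀ s, t s * u s = 1 := fun s ↦ by
    simp only [t, u, ← Complex.exp_add, add_neg_cancel, Complex.exp_zero]
  have ht : ∀ s, HasDerivAt t (t s) s := Complex.hasDerivAt_exp
  have hu : ∀ s, HasDerivAt (fun s ↦ -u s) (u s) s := fun s ↦ by
    have := ((Complex.hasDerivAt_exp (-s)).comp s (hasDerivAt_neg s)).neg
    exact this.congr_deriv (by simp [u])
  -- The Weyl element `W` satisfies the equation `W' = h W` of `exp (s h)`. Once moved to the left
  -- of `W`, the derivatives of the three factors contribute `t e`, `u f + h - t e` and `-u f`, with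
  -- sum `h`.
  have hw : ∀ s, HasDerivAt (fun s ↦ weylElement e f (t s) (u s))
      (h * weylElement e f (t s) (u s)) s := by
    intro s
    have d1 := (hasDerivAt_exp_smul_const' (𝕂 := ℂ) e (t s)).scomp s (ht s)
    have d2 := (hasDerivAt_exp_smul_const (𝕂 := ℂ) f (-u s)).scomp s (hu s)
    have d3 := (hasDerivAt_exp_smul_const (𝕂 := ℂ) e (t s)).scomp s (ht s)
    refine ((d1.mul d2).mul d3).congr_deriv ?_
    have c1 := weylElement_mul hef hhe hhf (htu s)
    have c2 := exp_smul_e_mul_f hef hhe (t s)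
    have c3 : exp (-u s • f) * f = f * exp (-u s • f) := by
      simpa using exp_smul_mul_eq_of_hasDerivAt (x := f) (y := fun _ ↦ f)
        (fun t ↦ by simpa using hasDerivAt_const t f) (-u s)
    simp only [Pi.mul_apply, Function.comp_apply]
    rw [c3]
    have c4 : exp (t s • e) * (u s • (f * exp (-u s • f))) * exp (t s • e) =
        (u s • (f + t s • h - (t s ^ 2) • e)) * weylElement e f (t s) (u s) := by
      rw [mul_smul_comm, ← mul_assoc, c2, weylElement]
      simp only [mul_assoc, smul_mul_assoc]
    have c5 : exp (t s • e) * exp (-u s • f) * (t s • (exp (t s • e) * e)) =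
        (t s • (-(u s ^ 2) • f)) * weylElement e f (t s) (u s) := by
      rw [mul_smul_comm, ← mul_assoc, smul_mul_assoc, ← c1]; rfl
    have c6 : t s • (e * exp (t s • e)) * exp (-u s • f) * exp (t s • e) =
        (t s • e) * weylElement e f (t s) (u s) := by
      simp only [weylElement, mul_assoc, smul_mul_assoc]
    rw [c5, add_mul, c6, c4, ← add_mul, ← add_mul]
    congr 1
    have e1 : u s * t s = 1 := by rw [mul_comm]; exact htu s
    simp only [smul_sub, smul_add, smul_smul, e1]
    rw [show u s * t s ^ 2 = t s by linear_combination t s * e1,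
      show t s * -u s ^ 2 = -u s by linear_combination -u s * e1]
    module
  have hd : ∀ s, HasDerivAt (fun s : ℂ ↦ exp (-(s • h)) * weylElement e f (t s) (u s)) 0 s := by
    intro s
    refine ((hasDerivAt_exp_neg_smul h s).mul (hw s)).congr_deriv ?_
    noncomm_ring
  have hc := is_const_of_deriv_eq_zero (fun s ↦ (hd s).differentiableAt) (fun s ↦ (hd s).deriv) s 0
  simp only [zero_smul, neg_zero, NormedSpace.exp_zero, one_mul] at hc
  -- The constant factor is the inverse of the Weyl element at `s = 0`, which fixes the initial
  -- value.
  have h0 : weylElement e f (t 0) (u 0) * (exp (-e) * exp f * exp (-e)) = 1 := by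
    simp only [weylElement, t, u, Complex.exp_zero, neg_zero, one_smul, neg_smul]
    calc _ = exp e * (exp (-f) * (exp e * exp (-e)) * exp f) * exp (-e) := by
          simp only [mul_assoc]
      _ = 1 := by rw [exp_mul_exp_neg, mul_one, exp_neg_mul_exp, mul_one, exp_mul_exp_neg]
  calc exp (s • h) = exp (s • h) * (exp (-(s • h)) * weylElement e f (t s) (u s) *
        (exp (-e) * exp f * exp (-e))) := by rw [hc, h0, mul_one]
    _ = _ := by rw [← mul_assoc, ← mul_assoc (exp (s • h)), exp_mul_exp_neg, one_mul]

end BanachAlgebra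

/-- The exponential of a matrix depends on the topology alone, so a norm is chosen only for the
proof. -/
theorem exp_smul_eq_of_sl2_relations {ι : Type*} [Fintype ι] [DecidableEq ι]
    {h e f : Matrix ι ι ℂ} (hef : e * f - f * e = h) (hhe : h * e - e * h = 2 • e)
    (hhf : h * f - f * h = -(2 • f)) (s : ℂ) :
    NormedSpace.exp (s • h) = NormedSpace.exp (Complex.exp s • e) *
      NormedSpace.exp (-Complex.exp (-s) • f) * NormedSpace.exp (Complex.exp s • e) *
      (NormedSpace.exp (-e) * NormedSpace.exp f * NormedSpace.exp (-e)) :=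
  open scoped Matrix.Norms.Operator in exp_smul_eq_weylElement hef hhe hhf s

theorem matrix_exp_smul_mul_eq_of_eigenvector {ι : Type*} [Fintype ι] [DecidableEq ι]
    {x y : Matrix ι ι ℂ} {a : ℂ} (h : x * y - y * x = a • y) (t : ℂ) :
    NormedSpace.exp (t • x) * y = (Complex.exp (t * a) • y) * NormedSpace.exp (t • x) :=
  open scoped Matrix.Norms.Operator in exp_smul_mul_eq_of_eigenvector h t

open Laurent

theorem Laurent.xi_mul_xi (m n : ℤ) : xi m * xi n = xi (m + n) := by
  have := HahnSeries.single_mul_single (a := m) (b := n) (r := (1 : ℂ)) (s := 1)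
  rw [mul_one] at this
  exact this

theorem Laurent.xi_zero : xi 0 = 1 := rfl

/-! ### Values of matrix-valued Laurent polynomials at `t = ξ` -/

section LaurentValue

variable {ι : Type*} [Fintype ι] [DecidableEq ι]

/-- The matrix-valued function `F` of `s` is a Laurent polynomial in `t = exp s`, and `τ` is its
value at `t = ξ`. -/
def IsLaurentValue (F : ℂ → Matrix ι ι ℂ) (τ : Matrix ι ι Laurent) : Prop :=
  ∃ A : ℤ →₀ Matrix ι ι ℂ,
    (∀ s : ℂ, F s = A.sum fun n M ↦ Complex.exp (s * n) • M) ∧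
    τ = A.sum fun n M ↦ xi n • M.map (algebraMap ℂ Laurent)

/-- Matrices over `ℂ` as matrices over `ℂ((ξ))`. -/
abbrev constMatrix : Matrix ι ι ℂ →ₐ[ℂ] Matrix ι ι Laurent :=
  (Algebra.ofId ℂ Laurent).mapMatrix

theorem constMatrix_apply (M : Matrix ι ι ℂ) : constMatrix M = M.map (algebraMap ℂ Laurent) := rfl

omit [Fintype ι] [DecidableEq ι] in
-- The functions `s ↦ exp (n s)` are distinct characters of the additive group `ℂ`, hence linearly
-- independent; this applies to each matrix entry.
theorem finsupp_eq_zero_of_sum_exp_smul {A : ℤ →₀ Matrix ι ι ℂ}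
    (hA : ∀ s : ℂ, (A.sum fun n M ↦ Complex.exp (s * n) • M) = 0) : A = 0 := by
  let χ : ℤ → Multiplicative ℂ →* ℂ := fun n ↦
    { toFun := fun s ↦ Complex.exp (s.toAdd * n)
      map_one' := by simp
      map_mul' := fun s t ↦ by rw [toAdd_mul, add_mul, Complex.exp_add] }
  have hχ : Function.Injective χ := by
    intro m n hmn
    have h := DFunLike.congr_fun hmn (Multiplicative.ofAdd 1)
    change Complex.exp (1 * m) = Complex.exp (1 * n) at h
    rw [one_mul, one_mul, ← Complex.ofReal_intCast, ← Complex.ofReal_intCast,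
      ← Complex.ofReal_exp, ← Complex.ofReal_exp, Complex.ofReal_inj] at h
    exact_mod_cast Real.exp_injective h
  have hli := (linearIndependent_monoidHom (Multiplicative ℂ) ℂ).comp χ hχ
  ext n i j
  by_cases hn : n ∈ A.support
  · refine linearIndependent_iff'.mp hli A.support (fun n ↦ A n i j) (funext fun s ↦ ?_) n hn
    have := congrFun (congrFun (hA s.toAdd) i) j
    rw [Finsupp.sum, Matrix.sum_apply] at this
    rw [Finset.sum_apply]
    refine Eq.trans (Finset.sum_congr rfl fun n _ ↦ ?_) this
    rw [Matrix.smul_apply]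
    exact mul_comm _ _
  · rw [Finsupp.notMem_support_iff.mp hn]; rfl

omit [Fintype ι] [DecidableEq ι] in
-- The value at `t = ξ` depends on the function alone. This makes `τ_μ` well defined, and it carries
-- identities between matrix functions of `s` over to `ℂ((ξ))`.
theorem IsLaurentValue.unique {F : ℂ → Matrix ι ι ℂ} {τ τ' : Matrix ι ι Laurent}
    (h : IsLaurentValue F τ) (h' : IsLaurentValue F τ') : τ = τ' := by
  obtain ⟨A, hA, rfl⟩ := h
  obtain ⟨B, hB, rfl⟩ := h'
  have : A - B = 0 := finsupp_eq_zero_of_sum_exp_smul fun s ↦ by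
    rw [Finsupp.sum_sub_index fun n M N ↦ smul_sub _ M N, ← hA, ← hB, sub_self]
  rw [sub_eq_zero.mp this]

theorem IsLaurentValue.monomial (n : ℤ) (M : Matrix ι ι ℂ) :
    IsLaurentValue (fun s ↦ Complex.exp (s * n) • M) (xi n • constMatrix M) :=
  ⟨Finsupp.single n M, fun s ↦ (Finsupp.sum_single_index
    (h := fun (n : ℤ) M ↦ Complex.exp (s * n) • M) (smul_zero _)).symm, by
    rw [Finsupp.sum_single_index, constMatrix_apply]
    rw [← constMatrix_apply, map_zero, smul_zero]⟩

theorem IsLaurentValue.const (M : Matrix ι ι ℂ) :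
    IsLaurentValue (fun _ ↦ M) (constMatrix M) := by
  simpa [xi_zero] using IsLaurentValue.monomial 0 M

theorem IsLaurentValue.add {F G : ℂ → Matrix ι ι ℂ} {τ υ : Matrix ι ι Laurent}
    (hF : IsLaurentValue F τ) (hG : IsLaurentValue G υ) :
    IsLaurentValue (fun s ↦ F s + G s) (τ + υ) := by
  obtain ⟨A, hA, rfl⟩ := hF
  obtain ⟨B, hB, rfl⟩ := hG
  refine ⟨A + B, fun s ↦ ?_, ?_⟩
  · beta_reduce
    rw [hA, hB, Finsupp.sum_add_index' (fun _ ↦ smul_zero _) (fun _ ↦ smul_add _)]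
  · simp only [← constMatrix_apply]
    rw [Finsupp.sum_add_index' (fun _ ↦ by rw [map_zero, smul_zero])
      (fun _ _ _ ↦ by rw [map_add, smul_add])]

theorem IsLaurentValue.sum {κ : Type*} (S : Finset κ) {F : κ → ℂ → Matrix ι ι ℂ}
    {τ : κ → Matrix ι ι Laurent} (h : ∀ k ∈ S, IsLaurentValue (F k) (τ k)) :
    IsLaurentValue (fun s ↦ ∑ k ∈ S, F k s) (∑ k ∈ S, τ k) := by
  classical
  induction S using Finset.induction_on with
  | empty => simpa using IsLaurentValue.const (0 : Matrix ι ι ℂ)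
  | insert k S hk ih =>
    simp only [Finset.sum_insert hk]
    exact (h k (Finset.mem_insert_self k S)).add
      (ih fun j hj ↦ h j (Finset.mem_insert_of_mem hj))

theorem IsLaurentValue.mul {F G : ℂ → Matrix ι ι ℂ} {τ υ : Matrix ι ι Laurent}
    (hF : IsLaurentValue F τ) (hG : IsLaurentValue G υ) :
    IsLaurentValue (fun s ↦ F s * G s) (τ * υ) := by
  obtain ⟨A, hA, rfl⟩ := hF
  obtain ⟨B, hB, rfl⟩ := hG
  have h : IsLaurentValue (fun s ↦ ∑ m ∈ A.support, ∑ n ∈ B.support,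
      Complex.exp (s * (m + n : ℤ)) • (A m * B n))
      (∑ m ∈ A.support, ∑ n ∈ B.support, xi (m + n) • constMatrix (A m * B n)) :=
    .sum _ fun m _ ↦ .sum _ fun n _ ↦ .monomial _ _
  convert h using 1
  · funext s
    rw [hA, hB, Finsupp.sum, Finsupp.sum, Finset.sum_mul_sum]
    refine Finset.sum_congr rfl fun m _ ↦ Finset.sum_congr rfl fun n _ ↦ ?_
    rw [smul_mul_smul_comm, ← Complex.exp_add]
    push_cast
    rw [mul_add]
  · rw [Finsupp.sum, Finsupp.sum, Finset.sum_mul_sum]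
    refine Finset.sum_congr rfl fun m _ ↦ Finset.sum_congr rfl fun n _ ↦ ?_
    rw [← constMatrix_apply, ← constMatrix_apply, smul_mul_smul_comm, xi_mul_xi, map_mul]

/-- The matrix `exp (c tᵐ N)` takes the value `exp (c ξᵐ N)` at `t = ξ`. -/
theorem isLaurentValue_exp {N : Matrix ι ι ℂ} (hN : IsNilpotent N) (c : ℂ) (m : ℤ) :
    IsLaurentValue (fun s ↦ NormedSpace.exp ((c * Complex.exp (s * m)) • N))
      (expUnit N hN (c • xi m)) := by
  obtain ⟨k, hk⟩ := id hN
  have h : IsLaurentValue (fun s ↦ ∑ l ∈ Finset.range k,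
      Complex.exp (s * (l * m : ℤ)) • (((l.factorial : ℂ)⁻¹ * c ^ l) • N ^ l))
      (∑ l ∈ Finset.range k, xi (l * m) • constMatrix (((l.factorial : ℂ)⁻¹ * c ^ l) • N ^ l)) :=
    .sum _ fun l _ ↦ .monomial _ _
  have hpow : ∀ l : ℕ, xi m ^ l = xi (l * m) := by
    intro l
    induction l with
    | zero => simp [xi_zero]
    | succ l ih => rw [pow_succ, ih, xi_mul_xi]; push_cast; rw [add_mul, one_mul]
  convert h using 1
  · funext s
    rw [normedSpaceExp_eq_nilpotentExp (hN.smul _),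
      IsNilpotent.exp_eq_sum (k := k) (by rw [smul_pow, hk, smul_zero])]
    refine Finset.sum_congr rfl fun l _ ↦ ?_
    rw [smul_pow, mul_pow, ← Complex.exp_nat_mul, smul_smul,
      ← Rat.cast_smul_eq_qsmul ℂ, smul_smul]
    congr 1
    push_cast
    ring_nf
  · change IsNilpotent.exp ((c • xi m) • constMatrix N) = _
    rw [IsNilpotent.exp_eq_sum (k := k) (by rw [smul_pow, ← map_pow, hk, map_zero, smul_zero])]
    refine Finset.sum_congr rfl fun l _ ↦ ?_
    -- The rational scalars in `IsNilpotent.exp` act on `ℂ((ξ))` through `ℂ`, by the choice of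
    -- instance.
    have hq : ∀ (q : ℚ) (M : Matrix ι ι Laurent), q • M = (q : ℂ) • M := by
      intro q M
      refine Matrix.ext fun i j ↦ ?_
      rw [Matrix.smul_apply, Matrix.smul_apply, Algebra.smul_def]
      exact (Algebra.smul_def (q : ℂ) (M i j)).symm
    rw [hq, smul_pow, smul_pow, hpow, map_smul, map_pow, smul_assoc, smul_smul, smul_comm (xi _)]
    push_cast
    rfl

end LaurentValue

/-! ### Words that represent the one-parameter subgroups of the coroot lattice -/

section Words

variable {g : Type*} [LieRing g] [LieAlgebra ℂ g] [FiniteDimensional ℂ g]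
  [LieAlgebra.IsKilling ℂ g] (H : LieSubalgebra ℂ g) [H.IsCartanSubalgebra]
  {ι : Type*} [Fintype ι] [DecidableEq ι] (ρ : g →ₗ⁅ℂ⁆ Matrix ι ι ℂ)

/-- The matrix over `ℂ((ξ))` represented by a word. -/
def wordMatrix : FreeExp H →* Matrix ι ι Laurent :=
  (Units.coeHom _).comp ((loopGroup ρ).subtype.comp (freeToLoop H ρ))

theorem wordMatrix_apply (w : FreeExp H) : wordMatrix H ρ w =
    ((freeToLoop H ρ w : Matrix.GeneralLinearGroup ι Laurent) : Matrix ι ι Laurent) := rfl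

theorem wordMatrix_of (r : RootLoop H) :
    wordMatrix H ρ (FreeGroup.of r) = expUnit (ρ r.vec) (r.isNilpotent_rep ρ) r.fn := by
  rw [wordMatrix_apply, freeToLoop, FreeGroup.lift_apply_of]; rfl

theorem isLaurentValue_wordMatrix_of (α : H.root) {x : g} (hx : x ∈ LieAlgebra.rootSpace H α.1)
    (c : ℂ) (m : ℤ) :
    IsLaurentValue (fun s ↦ NormedSpace.exp ((c * Complex.exp (s * m)) • ρ x))
      (wordMatrix H ρ (FreeGroup.of ⟨α, x, hx, c • xi m⟩)) := by
  rw [wordMatrix_of]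
  exact isLaurentValue_exp _ c m

variable {ρ} in
omit [FiniteDimensional ℂ g] [LieAlgebra.IsKilling ℂ g] in
theorem isExpLog_of_exp_eq {x : g} {F : ℂ → Matrix ι ι ℂ} {τ : Matrix ι ι Laurent}
    (hF : ∀ s : ℂ, NormedSpace.exp (s • ρ x) = F s) (h : IsLaurentValue F τ) :
    IsExpLog ρ x τ := by
  rwa [← funext hF] at h

/-- In the `SL₂` factorization of `exp (s h)` each factor involves a single root vector, with a
coefficient `c exp (m s)`; replacing this by `c ξ ^ m` makes the factor a generator. -/
theorem exists_isExpLog_coroot (α : H.root) : ∃ w : FreeExp H,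
    IsExpLog ρ (LieAlgebra.IsKilling.coroot α.1 : g) (wordMatrix H ρ w) := by
  have hα : α.1.IsNonZero := (Finset.mem_filter.mp α.2).2
  obtain ⟨h, e, f, ht, he, hf⟩ := LieAlgebra.IsKilling.exists_isSl2Triple_of_weight_isNonZero hα
  obtain rfl := ht.h_eq_coroot hα he hf
  let β : H.root := ⟨-α.1, by simpa using hα⟩
  have hf' : f ∈ LieAlgebra.rootSpace H β.1 := by
    simpa only [β, LieModule.Weight.coe_neg] using hf
  let E := fun (c : ℂ) (m : ℤ) ↦ FreeGroup.of (⟨α, e, he, c • xi m⟩ : RootLoop H)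
  let F := fun (c : ℂ) (m : ℤ) ↦ FreeGroup.of (⟨β, f, hf', c • xi m⟩ : RootLoop H)
  -- The first three letters are the Weyl element at `t = ξ`, `u = ξ⁻¹`; the last three are its
  -- inverse at `t = u = 1`.
  refine ⟨E 1 1 * F (-1) (-1) * E 1 1 * (E (-1) 0 * F 1 0 * E (-1) 0), ?_⟩
  have hE := isLaurentValue_wordMatrix_of H ρ α he
  have hF := isLaurentValue_wordMatrix_of H ρ β hf'
  have key := (((hE 1 1).mul (hF (-1) (-1))).mul (hE 1 1)).mul
    (((hE (-1) 0).mul (hF 1 0)).mul (hE (-1) 0))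
  simp only [map_mul]
  refine isExpLog_of_exp_eq (fun s ↦ ?_) key
  rw [exp_smul_eq_of_sl2_relations (h := ρ (LieAlgebra.IsKilling.coroot α.1 : H))
    (e := ρ e) (f := ρ f) (by rw [← ht.lie_e_f, LieHom.map_lie]; rfl)
    (by rw [← map_nsmul, ← ht.lie_h_e_nsmul, LieHom.map_lie]; rfl)
    (by rw [← map_nsmul, ← map_neg, ← ht.lie_h_f_nsmul, LieHom.map_lie]; rfl)]
  simp

/-- Since `H` is abelian, a sum in the coroot lattice goes to a product of one-parameter subgroups,
hence to a product of words. -/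
theorem exists_isExpLog {μ : H} (hμ : μ ∈ corootLattice H) : ∃ w : FreeExp H,
    IsExpLog ρ (μ : g) (wordMatrix H ρ w) := by
  -- As a monoid, the lattice is generated by the coroots and their negatives. The negatives are the
  -- coroots of the opposite roots, so inverse matrices never have to be evaluated at `ξ`.
  rw [corootLattice, ← AddSubgroup.mem_toAddSubmonoid, AddSubgroup.closure_toAddSubmonoid] at hμ
  induction hμ using AddSubmonoid.closure_induction with
  | mem μ hμ =>
    rcases hμ with ⟨α, rfl⟩ | ⟨α, hα⟩
    · exact exists_isExpLog_coroot H ρ α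
    · have h0 : α.1.IsNonZero := (Finset.mem_filter.mp α.2).2
      have := exists_isExpLog_coroot H ρ ⟨-α.1, by simpa using h0⟩
      rwa [LieAlgebra.IsKilling.coroot_neg, show LieAlgebra.IsKilling.coroot α.1 = -μ from hα,
        neg_neg] at this
  | zero =>
    refine ⟨1, ?_⟩
    have := IsLaurentValue.const (1 : Matrix ι ι ℂ)
    simpa [IsExpLog, IsLaurentValue, NormedSpace.exp_zero] using this
  | add μ ν _ _ ihμ ihν =>
    obtain ⟨w, hw⟩ := ihμ
    obtain ⟨w', hw'⟩ := ihν
    refine ⟨w * w', ?_⟩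
    rw [map_mul]
    refine isExpLog_of_exp_eq (fun s ↦ ?_) (IsLaurentValue.mul hw hw')
    rw [AddMemClass.coe_add, map_add, smul_add]
    refine Matrix.exp_add_of_commute _ _ ?_
    refine Commute.smul_left (Commute.smul_right ?_ s) s
    have h : ⁅μ, ν⁆ = 0 := trivial_lie_zero H H μ ν
    have h2 : ⁅ρ (μ : g), ρ (ν : g)⁆ = 0 := by
      rw [← LieHom.map_lie, ← LieSubalgebra.coe_bracket, h, ZeroMemClass.coe_zero, map_zero]
    exact sub_eq_zero.mp h2

end Words

/-! ### The adjoint action modulo the centre -/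

section Conjugation

/-- The commutator with `a` is the sum of left multiplication by `a` and right multiplication by
`-a`, two commuting nilpotent maps, so its exponential is the product of theirs. -/
theorem nilpotentExp_ad_apply {A : Type*} [Ring A] [Algebra ℂ A] [Module ℚ A] {a : A}
    (ha : IsNilpotent a) (x : A) :
    IsNilpotent (LinearMap.mulLeft ℂ a - LinearMap.mulRight ℂ a) ∧
    IsNilpotent.exp (LinearMap.mulLeft ℂ a - LinearMap.mulRight ℂ a) x =
      IsNilpotent.exp a * x * IsNilpotent.exp (-a) := by
  obtain ⟨k, hk⟩ := id ha
  have hL : LinearMap.mulLeft ℂ a ^ k = 0 := by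
    rw [LinearMap.pow_mulLeft, hk, LinearMap.mulLeft_zero_eq_zero]
  have hR : LinearMap.mulRight ℂ (-a) ^ k = 0 := by
    rw [LinearMap.pow_mulRight, neg_pow, hk, mul_zero, LinearMap.mulRight_zero_eq_zero]
  have hc : Commute (LinearMap.mulLeft ℂ a) (LinearMap.mulRight ℂ (-a)) :=
    LinearMap.commute_mulLeft_right a (-a)
  have hs : LinearMap.mulLeft ℂ a - LinearMap.mulRight ℂ a =
      LinearMap.mulLeft ℂ a + LinearMap.mulRight ℂ (-a) := by
    ext y; simp [sub_eq_add_neg]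
  rw [hs]
  refine ⟨hc.isNilpotent_add ⟨k, hL⟩ ⟨k, hR⟩, ?_⟩
  have hk' : (-a) ^ k = 0 := by rw [neg_pow, hk, mul_zero]
  have hq : ∀ (q : ℚ) (y : A), q • y = (q : ℂ) • y := fun q y ↦ (Rat.cast_smul_eq_qsmul ℂ q y).symm
  rw [IsNilpotent.exp_add_of_commute hc ⟨k, hL⟩ ⟨k, hR⟩, Module.End.mul_apply,
    IsNilpotent.exp_eq_sum hL, IsNilpotent.exp_eq_sum hR, IsNilpotent.exp_eq_sum hk,
    IsNilpotent.exp_eq_sum hk']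
  simp only [LinearMap.sum_apply, LinearMap.smul_apply, LinearMap.pow_mulLeft,
    LinearMap.pow_mulRight, LinearMap.mulLeft_apply, LinearMap.mulRight_apply, hq,
    Finset.sum_mul, mul_assoc, Finset.mul_sum, smul_mul_assoc, mul_smul_comm]
  simp only [Finset.smul_sum]
  rw [Finset.sum_comm]
  exact Finset.sum_congr rfl fun i _ ↦ Finset.sum_congr rfl fun j _ ↦ smul_comm _ _ _

variable {g : Type*} [LieRing g] [LieAlgebra ℂ g]
  {ι : Type*} [Fintype ι] [DecidableEq ι] (ρ : g →ₗ⁅ℂ⁆ Matrix ι ι ℂ)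

/-- The representation `X ⊗ f ↦ f ρ(X)` of the loop algebra. -/
def loopRep : LoopAlgebra g →ₗ[ℂ] Matrix ι ι Laurent :=
  (matrixEquivTensor ι ℂ Laurent).symm.toLinearMap ∘ₗ (ρ : g →ₗ[ℂ] Matrix ι ι ℂ).lTensor Laurent

theorem loopRep_tmul (f : Laurent) (x : g) : loopRep ρ (f ⊗ₜ x) = f • constMatrix (ρ x) := rfl

variable {ρ} in
theorem loopRep_injective (hρ : Function.Injective ρ) : Function.Injective (loopRep ρ) :=
  (matrixEquivTensor ι ℂ Laurent).symm.injective.comp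
    (Module.Flat.lTensor_preserves_injective_linearMap _ hρ)

theorem loopRep_lie (x y : LoopAlgebra g) :
    loopRep ρ ⁅x, y⁆ = loopRep ρ x * loopRep ρ y - loopRep ρ y * loopRep ρ x := by
  induction x using TensorProduct.induction_on with
  | zero => simp
  | add x x' hx hx' => rw [add_lie, map_add, hx, hx', map_add]; noncomm_ring
  | tmul f a =>
    induction y using TensorProduct.induction_on with
    | zero => simp
    | add y y' hy hy' => rw [lie_add, map_add, hy, hy', map_add]; noncomm_ring
    | tmul f' b =>
      rw [LieAlgebra.ExtendScalars.bracket_tmul, loopRep_tmul, loopRep_tmul, loopRep_tmul,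
        LieHom.map_lie, Ring.lie_def, map_sub, map_mul, map_mul, smul_mul_smul_comm,
        smul_mul_smul_comm, mul_comm f' f, smul_sub]

/-! ### The adjoint action as conjugation over `ℂ((ξ))` -/

section Affine

variable [FiniteDimensional ℂ g] [LieAlgebra.IsKilling ℂ g]
  (H : LieSubalgebra ℂ g) [H.IsCartanSubalgebra]

/-- The representation of the affine Lie algebra in which `c` acts by zero. -/
def affineRep : AffineAlgebra H →ₗ[ℂ] Matrix ι ι Laurent :=
  loopRep ρ ∘ₗ LinearMap.fst ℂ (LoopAlgebra g) ℂ

omit [FiniteDimensional ℂ g] [LieAlgebra.IsKilling ℂ g] in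
theorem affineRep_loopElt (x : g) (f : Laurent) :
    affineRep ρ H (loopElt H x f) = f • constMatrix (ρ x) := rfl

theorem affineRep_lie (x y : AffineAlgebra H) : affineRep ρ H ⁅x, y⁆ =
    affineRep ρ H x * affineRep ρ H y - affineRep ρ H y * affineRep ρ H x :=
  loopRep_lie ρ x.1 y.1

theorem expAd_apply (r : RootLoop H) (x : AffineAlgebra H) :
    (r.expAd : AffineAlgebra H ≃ₗ[ℂ] AffineAlgebra H) x =
      IsNilpotent.exp (LieAlgebra.ad ℂ (AffineAlgebra H) r.elt) x := by
  have h : (LieDerivation.ad ℂ (AffineAlgebra H) r.elt).toLinearMap =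
      LieAlgebra.ad ℂ (AffineAlgebra H) r.elt :=
    LinearMap.ext fun w ↦ LieDerivation.ad_apply_apply ℂ _ _ w
  rw [← h]
  exact LieDerivation.exp_map_apply _ r.isNilpotent_adDerivation x

/-- The representation intertwines `ad (X ⊗ f)` with the commutator by `a = f ρ(X)`, hence also
their exponentials, and the exponential of the commutator is conjugation by `exp a`. -/
theorem affineRep_expAd (r : RootLoop H) (x : AffineAlgebra H) :
    affineRep ρ H ((r.expAd : AffineAlgebra H ≃ₗ[ℂ] AffineAlgebra H) x) *
        wordMatrix H ρ (FreeGroup.of r) =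
      wordMatrix H ρ (FreeGroup.of r) * affineRep ρ H x := by
  set a : Matrix ι ι Laurent := r.fn • constMatrix (ρ r.vec)
  have ha : IsNilpotent a := ((r.isNilpotent_rep ρ).map constMatrix).smul r.fn
  have h := Module.End.commute_exp_left_of_commute (g := affineRep ρ H)
    r.isNilpotent_ad (nilpotentExp_ad_apply ha 0).1 (LinearMap.ext fun y ↦
      (affineRep_lie ρ H r.elt y).symm)
  have h' := LinearMap.congr_fun h x
  rw [LinearMap.comp_apply, (nilpotentExp_ad_apply ha _).2] at h'
  rw [wordMatrix_of, expAd_apply]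
  change _ * IsNilpotent.exp a = IsNilpotent.exp a * _
  rw [LinearMap.comp_apply] at h'
  rw [← h', mul_assoc, IsNilpotent.exp_neg_mul_exp_self ha, mul_one]

/-- For faithful `ρ` this determines the adjoint action modulo the centre from the matrix of the
word. -/
theorem affineRep_freeAd (w : FreeExp H) (x : AffineAlgebra H) :
    affineRep ρ H ((freeAd H w : AffineAlgebra H ≃ₗ[ℂ] AffineAlgebra H) x) * wordMatrix H ρ w =
      wordMatrix H ρ w * affineRep ρ H x := by
  induction w using FreeGroup.induction_on generalizing x with
  | C1 => simp
  | of r =>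
    rw [freeAd, FreeGroup.lift_apply_of]
    exact affineRep_expAd ρ H r x
  | inv_of r h =>
    set w := FreeGroup.of r
    have h1 := h ((freeAd H w⁻¹ : AffineAlgebra H ≃ₗ[ℂ] AffineAlgebra H) x)
    rw [← LinearEquiv.mul_apply, ← Subgroup.coe_mul, ← map_mul, mul_inv_cancel, map_one] at h1
    have h2 : wordMatrix H ρ w * wordMatrix H ρ w⁻¹ = 1 := by
      rw [← map_mul, mul_inv_cancel, map_one]
    have h3 : wordMatrix H ρ w⁻¹ * wordMatrix H ρ w = 1 := by
      rw [← map_mul, inv_mul_cancel, map_one]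
    replace h1 : affineRep ρ H x * wordMatrix H ρ w = _ := h1
    calc _ = wordMatrix H ρ w⁻¹ * (wordMatrix H ρ w * affineRep ρ H _) *
          wordMatrix H ρ w⁻¹ := by rw [← mul_assoc (wordMatrix H ρ w⁻¹), h3, one_mul]
      _ = _ := by rw [← h1, mul_assoc, mul_assoc, h2, mul_one]
  | mul w w' hw hw' =>
    rw [map_mul, map_mul, Subgroup.coe_mul, LinearEquiv.mul_apply, ← mul_assoc, hw, mul_assoc, hw',
      mul_assoc]

theorem freeAd_centralElt (w : FreeExp H) :
    (freeAd H w : AffineAlgebra H ≃ₗ[ℂ] AffineAlgebra H) (centralElt H) = centralElt H := by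
  induction w using FreeGroup.induction_on with
  | C1 => simp
  | of r =>
    rw [freeAd, FreeGroup.lift_apply_of]
    -- As `ad (X ⊗ f)` kills `c`, only the term of degree zero survives on `c`.
    have h := IsNilpotent.exp_smul_eq_sum (k := 1) (m := centralElt H)
      (by rw [pow_one]; exact lie_centralElt H r.elt) r.isNilpotent_ad
    rw [expAd_apply]
    simpa using h
  | inv_of r h =>
    rw [map_inv]
    exact (LinearEquiv.symm_apply_eq _).mpr h.symm
  | mul w w' hw hw' => rw [map_mul, Subgroup.coe_mul, LinearEquiv.mul_apply, hw', hw]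

end Affine

end Conjugation

/-! ### Single-shift maps are automorphisms -/

theorem Laurent.derivative_xi (m : ℤ) : derivative (xi m) = (m : ℂ) • xi (m - 1) := by
  ext k
  rw [coeff_derivative, map_smul]
  change _ * HahnSeries.coeff (HahnSeries.single m (1 : ℂ)) (k + 1) =
    _ * HahnSeries.coeff (HahnSeries.single (m - 1) (1 : ℂ)) k
  rw [HahnSeries.coeff_single, HahnSeries.coeff_single]
  by_cases hk : k + 1 = m
  · rw [if_pos hk, if_pos (by omega), ← hk]; push_cast; ring
  · rw [if_neg hk, if_neg (by omega)]; simp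

theorem Laurent.residue_xi_mul (f : Laurent) : residue (xi (-1) * f) = coeff 0 f := by
  have := HahnSeries.coeff_single_mul_add (r := (1 : ℂ)) (x := (show LaurentSeries ℂ from f))
    (a := 0) (b := -1)
  rw [one_mul, zero_add] at this
  exact this

/-- By the product rule, differentiating `ξ ^ a` adds `a ξ⁻¹ f f'`, whose residue is `a` times the
constant coefficient of `f f'`. This is the change of the cocycle that the central term of `σ_μ` has
to match. -/
theorem Laurent.residue_xi_mul_derivative {a b : ℤ} (hab : a + b = 0) (f f' : Laurent) :
    residue (xi b * f' * derivative (xi a * f)) =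
      a * coeff 0 (f * f') + residue (f' * derivative f) := by
  have e : xi b * f' * derivative (xi a * f) =
      (a : ℂ) • ((xi b * xi (a - 1)) * (f * f')) + (xi b * xi a) * (f' * derivative f) := by
    rw [derivative_mul, derivative_xi, mul_add, smul_mul_assoc, mul_smul_comm]
    congr 1
    · congr 1; ring
    · ring
  rw [e, xi_mul_xi, xi_mul_xi, show b + (a - 1) = -1 by omega, show b + a = 0 by omega, xi_zero,
    one_mul, map_add, map_smul, residue_xi_mul, smul_eq_mul]

section Shift

variable {g : Type*} [LieRing g] [LieAlgebra ℂ g] [FiniteDimensional ℂ g]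
  [LieAlgebra.IsKilling ℂ g] (H : LieSubalgebra ℂ g) [H.IsCartanSubalgebra]

omit [LieAlgebra.IsKilling ℂ g] in
-- The weights include zero, so the Cartan subalgebra needs no separate case.
theorem rootSpace_induction {p : g → Prop}
    (mem : ∀ (α : LieModule.Weight ℂ H g), ∀ x ∈ LieAlgebra.rootSpace H α, p x)
    (zero : p 0) (add : ∀ x y, p x → p y → p (x + y)) (x : g) : p x := by
  have hx : x ∈ ⨆ α : LieModule.Weight ℂ H g, LieModule.genWeightSpace g (α : H → ℂ) := by
    rw [LieModule.iSup_genWeightSpace_eq_top' ℂ H g]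
    exact LieSubmodule.mem_top x
  exact LieSubmodule.iSup_induction _ (motive := p) hx mem zero add

omit [FiniteDimensional ℂ g] [LieAlgebra.IsKilling ℂ g] in
theorem loopElt_add (x y : g) (f : Laurent) :
    loopElt H (x + y) f = loopElt H x f + loopElt H y f :=
  Prod.ext (TensorProduct.tmul_add f x y) (add_zero 0).symm

omit [FiniteDimensional ℂ g] [LieAlgebra.IsKilling ℂ g] in
theorem loopElt_zero (f : Laurent) : loopElt H (0 : g) f = 0 :=
  Prod.ext (TensorProduct.tmul_zero g f) rfl

theorem centralElt_lie (x : AffineAlgebra H) : ⁅centralElt H, x⁆ = 0 := by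
  rw [← lie_skew, lie_centralElt, neg_zero]

/-- The cocycle differentiates its first argument, here the constant `1`, so no central term
appears. Together with `[g, g] = g` this writes every `X ⊗ f` as a sum of brackets in the affine
algebra. -/
theorem loopElt_lie_eq_lie (x y : g) (f : Laurent) :
    loopElt H ⁅x, y⁆ f = ⁅loopElt H y 1, loopElt H (-x) f⁆ := by
  have h : derivative (1 : Laurent) = 0 := by
    rw [← xi_zero, derivative_xi]; simp
  rw [lie_loopElt, h, mul_zero, map_zero, mul_zero, zero_smul, add_zero, one_mul, lie_neg,
    lie_skew]

/-- Invariance of the form moves the bracket onto `[μ, x] = α(μ) x`. -/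
theorem normalizedForm_coweight_lie (μ : coweightLattice H) {α : LieModule.Weight ℂ H g} {x : g}
    (hx : x ∈ LieAlgebra.rootSpace H α) (y : g) :
    normalizedForm H (μ.1 : g) ⁅x, y⁆ = coweightPairing H μ α * normalizedForm H x y := by
  have h : ⁅((μ.1 : H) : g), x⁆ = α μ.1 • x :=
    LieAlgebra.IsKilling.lie_eq_smul_of_mem_rootSpace hx μ.1
  rw [← normalizedForm_lie, h, coweightPairing_spec, map_smul, LinearMap.smul_apply, smul_eq_mul]

/-- The exponents add because `(α + β)(μ) = α(μ) + β(μ)`. If `α + β = 0`, the central term of `σ_μ`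
on the bracket equals the change of the cocycle under the shift; otherwise `(x, y) = 0` and both
vanish. -/
theorem singleShift_lie_of_mem (μ : coweightLattice H) {α β : LieModule.Weight ℂ H g} {x y : g}
    (hx : x ∈ LieAlgebra.rootSpace H α) (hy : y ∈ LieAlgebra.rootSpace H β) (f f' : Laurent) :
    singleShift H μ ⁅loopElt H x f, loopElt H y f'⁆ =
      ⁅singleShift H μ (loopElt H x f), singleShift H μ (loopElt H y f')⁆ := by
  set a := coweightPairing H μ α with ha
  set b := coweightPairing H μ β with hb
  have hxy : ⁅x, y⁆ ∈ LieAlgebra.rootSpace H (α + β : H → ℂ) :=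
    LieAlgebra.lie_mem_genWeightSpace_of_mem_genWeightSpace hx hy
  have h1 : singleShift H μ (loopElt H ⁅x, y⁆ (f * f')) =
      loopElt H ⁅x, y⁆ (xi a * f * (xi b * f')) +
        (coeff 0 (f * f') * (a * normalizedForm H x y)) • centralElt H := by
    rw [← normalizedForm_coweight_lie H μ hx]
    -- Only a nonzero bracket guarantees that `α + β` is a weight, to which a pairing with `μ` is
    -- attached.
    by_cases h0 : ⁅x, y⁆ = 0
    · rw [h0, loopElt_zero, loopElt_zero]; simp
    · have hne : LieAlgebra.rootSpace H (α + β : H → ℂ) ≠ ⊥ := by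
        intro hbot
        rw [hbot, LieSubmodule.mem_bot] at hxy
        exact h0 hxy
      let γ : LieModule.Weight ℂ H g := ⟨α + β, hne⟩
      have hγ : coweightPairing H μ γ = a + b := by
        have h := coweightPairing_spec H μ γ
        have h2 : γ μ.1 = α μ.1 + β μ.1 := rfl
        rw [h2, coweightPairing_spec, coweightPairing_spec] at h
        exact_mod_cast h.symm
      rw [singleShift_of_mem H μ γ hxy, hγ, ← xi_mul_xi]
      congr 2
      ring
  have h2 : normalizedForm H x y * residue (xi b * f' * derivative (xi a * f)) =
      coeff 0 (f * f') * (a * normalizedForm H x y) +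
        normalizedForm H x y * residue (f' * derivative f) := by
    by_cases hαβ : (α + β : H → ℂ) = 0
    · have hab : a + b = 0 := by
        have h := congrFun hαβ μ.1
        rw [Pi.add_apply, coweightPairing_spec, coweightPairing_spec, Pi.zero_apply] at h
        exact_mod_cast h
      rw [residue_xi_mul_derivative hab]
      ring
    · have h0 : normalizedForm H x y = 0 := by
        have := LieAlgebra.killingForm_apply_eq_zero_of_mem_rootSpace_of_add_ne_zero ℂ g H hx hy hαβ
        simp [normalizedForm, this]
      rw [h0]; ring
  rw [lie_loopElt, map_add, map_smul, singleShift_centralElt, h1, singleShift_of_mem H μ α hx,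
    singleShift_of_mem H μ β hy]
  simp only [lie_add, add_lie, lie_smul, smul_lie, lie_centralElt, centralElt_lie, smul_zero,
    add_zero]
  rw [lie_loopElt, ← ha, ← hb, h2, add_smul, add_assoc]

theorem singleShift_lie (μ : coweightLattice H) (x y : g) (f f' : Laurent) :
    singleShift H μ ⁅loopElt H x f, loopElt H y f'⁆ =
      ⁅singleShift H μ (loopElt H x f), singleShift H μ (loopElt H y f')⁆ := by
  induction x using rootSpace_induction H with
  | zero => simp [loopElt_zero]
  | add x x' hx hx' => simp only [loopElt_add, add_lie, map_add, hx, hx']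
  | mem α x hx =>
    induction y using rootSpace_induction H with
    | zero => simp [loopElt_zero]
    | add y y' hy hy' => simp only [loopElt_add, lie_add, map_add, hy, hy']
    | mem β y hy => exact singleShift_lie_of_mem H μ hx hy f f'

end Shift

/-! ### Automorphisms that agree modulo the centre -/

section Perfect

variable {g : Type*} [LieRing g] [LieAlgebra ℂ g]

/-- A simple Lie algebra is perfect: `[g, g]` is an ideal, and it is nonzero since `g` is not
abelian. Scalars are absorbed into one argument of the bracket. -/
theorem lie_induction [LieAlgebra.IsSimple ℂ g] {p : g → Prop} (lie : ∀ x y : g, p ⁅x, y⁆)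
    (zero : p 0) (add : ∀ x y, p x → p y → p (x + y)) (x : g) : p x := by
  have htop : ⁅(⊤ : LieIdeal ℂ g), (⊤ : LieIdeal ℂ g)⁆ = ⊤ := by
    refine (LieAlgebra.IsSimple.eq_bot_or_eq_top _).resolve_left fun h ↦ ?_
    refine LieAlgebra.IsSimple.non_abelian (R := ℂ) (L := g) ⟨fun x y ↦ ?_⟩
    have := LieSubmodule.lie_mem_lie (I := (⊤ : LieIdeal ℂ g)) (N := (⊤ : LieIdeal ℂ g))
      (LieSubmodule.mem_top x) (LieSubmodule.mem_top y)
    rwa [h, LieSubmodule.mem_bot] at this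
  have hx : x ∈ (⁅(⊤ : LieIdeal ℂ g), (⊤ : LieIdeal ℂ g)⁆ : LieIdeal ℂ g) := by
    rw [htop]; exact LieSubmodule.mem_top x
  rw [← LieSubmodule.mem_toSubmodule, LieSubmodule.lieIdeal_oper_eq_linear_span'] at hx
  have hspan : ∀ c : ℂ, ∀ x y : g, p (c • ⁅x, y⁆) := fun c x y ↦ by
    rw [← smul_lie]; exact lie _ _
  induction hx using Submodule.closure_induction with
  | zero => exact zero
  | add x y _ _ hx hy => exact add x y hx hy
  | smul_mem c x hx =>
    obtain ⟨y, -, z, -, rfl⟩ := hx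
    exact hspan c y z

variable [FiniteDimensional ℂ g] [LieAlgebra.IsSimple ℂ g] (H : LieSubalgebra ℂ g)
  [H.IsCartanSubalgebra] {ι : Type*} [Fintype ι] [DecidableEq ι] {ρ : g →ₗ⁅ℂ⁆ Matrix ι ι ℂ}

omit [FiniteDimensional ℂ g] [LieAlgebra.IsSimple ℂ g] in
theorem affineAlgebra_linearMap_ext {M : Type*} [AddCommGroup M] [Module ℂ M]
    {φ ψ : AffineAlgebra H →ₗ[ℂ] M} (hc : φ (centralElt H) = ψ (centralElt H))
    (h : ∀ (x : g) (f : Laurent), φ (loopElt H x f) = ψ (loopElt H x f)) : φ = ψ := by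
  refine LinearMap.prod_ext (TensorProduct.ext' fun f x ↦ h x f) (LinearMap.ext_ring hc)

/-- Because `c` is central, central discrepancies between the arguments are lost in the bracket. -/
theorem lie_eq_lie_of_fst_eq {x x' y y' : AffineAlgebra H} (hx : x.1 = x'.1) (hy : y.1 = y'.1) :
    ⁅x, y⁆ = ⁅x', y'⁆ := by
  change ((⁅x.1, y.1⁆, affineCocycle H x.1 y.1) : LoopAlgebra g × ℂ) =
    (⁅x'.1, y'.1⁆, affineCocycle H x'.1 y'.1)
  rw [hx, hy]

/-- Words whose matrix is `exp (ln ξ · ρ(μ))` act on the affine Lie algebra as the single-shift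
map of `μ`. -/
theorem freeAd_eq_singleShift (hρ : Function.Injective ρ) (μ : coweightLattice H)
    {w : FreeExp H} (hw : IsExpLog ρ (μ.1 : g) (wordMatrix H ρ w)) (x : AffineAlgebra H) :
    (freeAd H w : AffineAlgebra H ≃ₗ[ℂ] AffineAlgebra H) x = singleShift H μ x := by
  set φ : AffineAlgebra H ≃ₗ[ℂ] AffineAlgebra H := (freeAd H w).1
  have hw1 : wordMatrix H ρ w * wordMatrix H ρ w⁻¹ = 1 := by
    rw [← map_mul, mul_inv_cancel, map_one]
  -- For each `s`, conjugation by `exp (s ρ(μ))` multiplies `ρ(x)` by `exp (s α(μ))`. Both sides are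
  -- Laurent polynomials in `exp s`, and uniqueness of values gives the relation at `t = ξ`.
  have hτ : ∀ (α : LieModule.Weight ℂ H g), ∀ x ∈ LieAlgebra.rootSpace H α,
      wordMatrix H ρ w * constMatrix (ρ x) =
        xi (coweightPairing H μ α) • constMatrix (ρ x) * wordMatrix H ρ w := by
    intro α x hx
    refine IsLaurentValue.unique (IsLaurentValue.mul hw (.const (ρ x))) ?_
    have h2 : ρ (μ.1 : g) * ρ x - ρ x * ρ (μ.1 : g) = (coweightPairing H μ α : ℂ) • ρ x := by
      have h : ⁅((μ.1 : H) : g), x⁆ = α μ.1 • x :=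
        LieAlgebra.IsKilling.lie_eq_smul_of_mem_rootSpace hx μ.1
      rw [← coweightPairing_spec, ← map_smul, ← h, LieHom.map_lie]; rfl
    convert (IsLaurentValue.monomial (coweightPairing H μ α) (ρ x)).mul hw using 1
    funext s
    exact matrix_exp_smul_mul_eq_of_eigenvector h2 s
  -- Agreement modulo the centre: the matrices under the faithful loop representation are compared.
  have hfst : ∀ (x : g) (f : Laurent),
      (φ (loopElt H x f)).1 = (singleShift H μ (loopElt H x f)).1 := by
    intro x f
    induction x using rootSpace_induction H with
    | zero => rw [loopElt_zero, map_zero, map_zero]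
    | add x y hx hy =>
      rw [loopElt_add, map_add, map_add]
      exact congrArg₂ (· + ·) hx hy
    | mem α x hx =>
      apply loopRep_injective hρ
      change affineRep ρ H (φ (loopElt H x f)) = affineRep ρ H (singleShift H μ (loopElt H x f))
      have h1 := affineRep_freeAd ρ H w (loopElt H x f)
      have h2 : affineRep ρ H (centralElt H) = 0 := map_zero (loopRep ρ)
      rw [singleShift_of_mem H μ α hx, map_add, map_smul, h2, smul_zero, add_zero,
        affineRep_loopElt]
      rw [affineRep_loopElt, mul_smul_comm, hτ α x hx, ← smul_mul_assoc, smul_smul, mul_comm f]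
        at h1
      have h3 := congrArg (· * wordMatrix H ρ w⁻¹) h1
      simpa only [mul_assoc, hw1, mul_one] using h3
  refine LinearMap.congr_fun (f := φ.toLinearMap) (affineAlgebra_linearMap_ext H ?_ ?_) x
  · rw [singleShift_centralElt]
    exact freeAd_centralElt H w
  · intro x f
    -- On a bracket, agreement modulo the centre becomes agreement, since both maps respect
    -- brackets.
    induction x using lie_induction with
    | zero => rw [loopElt_zero, map_zero, map_zero]
    | add x y hx hy => rw [loopElt_add, map_add, map_add, hx, hy]
    | lie x y =>
      rw [loopElt_lie_eq_lie, singleShift_lie]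
      exact ((freeAd H w).2 _ _).trans (lie_eq_lie_of_fst_eq H (hfst _ _) (hfst _ _))

end Perfect

end SingleShift

end

/-! ### Shifts by the coroot lattice are inner -/

theorem corollary4p5 {g : Type*} [LieRing g] [LieAlgebra ℂ g] [FiniteDimensional ℂ g]
    [LieAlgebra.IsSimple ℂ g] (hg : IsClassical g)
    (H : LieSubalgebra ℂ g) [H.IsCartanSubalgebra]
    {ι : Type*} [Fintype ι] [DecidableEq ι] (ρ : g →ₗ⁅ℂ⁆ Matrix ι ι ℂ)
    (hρ : Function.Injective ρ) (hG : SimplyConnectedSpace (complexGroup ρ))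
    (μ : coweightLattice H) (hμ : (μ : H) ∈ corootLattice H) :
    ∃ τ : loopGroup ρ,
      (∀ τ' : Matrix ι ι Laurent, IsExpLog ρ (μ.1 : g) τ' ↔
        τ' = (τ : Matrix.GeneralLinearGroup ι Laurent)) ∧
      (∃ t : KacMoodyGroup H ρ, KacMoodyGroup.toLoop H ρ t = τ) ∧
      ∀ t : KacMoodyGroup H ρ, KacMoodyGroup.toLoop H ρ t = τ →
        ∀ x : AffineAlgebra H,
          (KacMoodyGroup.Ad H ρ t : AffineAlgebra H ≃ₗ[ℂ] AffineAlgebra H) x =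
            singleShift H μ x := by
  obtain ⟨w, hw⟩ := exists_isExpLog H ρ hμ
  refine ⟨freeToLoop H ρ w, fun τ' ↦ ⟨fun h ↦ IsLaurentValue.unique h hw, ?_⟩,
    ⟨QuotientGroup.mk w, rfl⟩, fun t ht x ↦ ?_⟩
  · rintro rfl
    exact hw
  · obtain ⟨v, rfl⟩ := QuotientGroup.mk_surjective t
    have hv : freeToLoop H ρ v = freeToLoop H ρ w := ht
    -- A word `v` for another lift has the same matrix as `w`, which is all that the comparison with
    -- `σ_μ` requires.
    rw [wordMatrix_apply, ← hv] at hw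
    exact freeAd_eq_singleShift H hρ μ hw x
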